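/- **Problem.** An instance of the asymmetric two-machine routing flow shop problem with $g\ge 1$ job nodes consists of $n$ jobs and a complete directed network whose nodes are a start-depot $0$, job nodes $1,\dots,g$ and a finish-depot $g+1$. The travel times $\rho_{u,v}\ge 0$ satisfy $\rho_{u,u}=0$ and the triangle inequality, and need not be symmetric. Each job is located at a job node, and each job node contains at least one job ($n_i\ge 1$ jobs at node $i$). Job $j$ has an operation of length $a_j\ge 0$ on machine $A$ and one of length $b_j\ge 0$ on machine $B$ (real numbers), and the operation on $B$ may start only after the one on $A$ is completed. At time $0$ both machines are at the start-depot. A machine performs one operation at a time, without interruption, and has to be at the node of the job while performing it; after all the jobs it travels to the finish-depot. A feasible schedule (starting times of all operations) is to be found that minimizes the time at which machine $B$ arrives at the finish-depot. **Algorithm $\mathcal A_{DP}$.** At each node the jobs are numbered by Johnson's rule (first the jobs with $a_j\le b_j$ by ascending $a_j$, then the others by descending $b_j$, ties broken by index). A configuration $(K,i^*)$, where $K=(k_1,\dots,k_g)$, $0\le k_i\le n_i$, $k_{i^*}>0$, means that exactly the first $k_i$ jobs of each node $i$ have been performed, the last one at node $i^*$. In the order of non-decreasing $\|K\|_1$,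 the algorithm builds for each configuration a list of pairwise incomparable (Pareto-optimal) pairs $(F_1,F_2)$ of completion times of the machines $A$ and $B$, sorted by ascending $F_1$. The list starts as the dummy pair $(0,\infty)$. For each $d=1,\dots,k_{i^*}$ let $L_1,L_2$ be the workloads of the two machines on the jobs $k_{i^*}-d+1,\dots,k_{i^*}$ of node $i^*$ and $C^*$ the minimum two-machine flow shop makespan of these jobs; for each admissible previous node $i'\ne i^*$ ($i'=0$ with the single pair $(0,0)$ if no job has been performed before, otherwise a job node $i'$ with $k_{i'}>0$), each pair $(F_1',F_2')$ of the configuration $(K',i')$, where $K'$ is $K$ with $k_{i^*}$ decreased by $d$, taken in ascending order of $F_1'$, yields the pair with $F_1''=F_1'+\rho_{i',i^*}+L_1$ and $F_2''=F_2'+\rho_{i',i^*}+L_2$ if $F_2'-F_1'\ge C^*-L_2$, and $F_2''=F_1'+\rho_{i',i^*}+C^*$ otherwise; after the first pair of the latter kind the enumeration for $(d,i')$ stops. A new pair is inserted if it is not majorized by the list, and the pairs that it majorizes are removed; the positions in the list are found by moving a pointer that never goes back while $(d,i')$ is fixed. Finally the algorithm takes the minimum of $F_2+\rho_{i,g+1}$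 over the last pairs of the lists for $((n_1,\dots,n_g),i)$, $i=1,\dots,g$, and restores a schedule from the recorded steps. **Theorem 3.** For every $g\ge 1$, algorithm $\mathcal A_{DP}$ finds, for every instance with $g$ job nodes, an optimal schedule and its objective value; and there is a constant $c$ depending only on $g$ such that its running time on every instance with $g$ job nodes and $n$ jobs is at most $c\,n^{g^2+1}$ elementary operations (arithmetic operations and comparisons on real numbers and other random-access-machine operations, each at unit cost). So for every fixed $g$ the running time is $O(n^{g^2+1})$, polynomial in $n$. -/

import Mathlib

namespace RoutingFlowShop

/-! ### The problem -/

/-- The nodes of the reduced network: the start-depot, `g` job nodes and the finish-depot. -/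
inductive Node (g : ℕ) : Type
  | start
  | job (i : Fin g)
  | finish

/-- An instance of the asymmetric two-machine routing flow shop problem with `g` job nodes.
There are `n` jobs; job `j` is located at the job node `loc j`, and its operations on machines `A`
and `B` last `a j` and `b j`. Every job node contains a job, the depots contain none. The travel
times are given by the complete directed network `dist`, which is not assumed symmetric. -/
structure Problem (g : ℕ) where
  n : ℕ
  loc : Fin n → Fin g
  a : Fin n → ℝ
  b : Fin n → ℝ
  dist : Node g → Node g → ℝ
  loc_surjective : Function.Surjective loc
  a_nonneg : ∀ j, 0 ≤ a j
  b_nonneg : ∀ j, 0 ≤ b j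
  dist_nonneg : ∀ u v, 0 ≤ dist u v
  dist_self : ∀ u, dist u u = 0
  dist_triangle : ∀ u v w, dist u w ≤ dist u v + dist v w

variable {g : ℕ}

/-- Travel time from the place of job `j` to the place of job `k`. -/
def Problem.travel (P : Problem g) (j k : Fin P.n) : ℝ :=
  P.dist (.job (P.loc j)) (.job (P.loc k))

/-- A schedule: the starting times of all operations (an operation of length `p` started at time
`s` is completed at time `s + p`; there are no preemptions). -/
structure Schedule (P : Problem g) where
  startA : Fin P.n → ℝ
  startB : Fin P.n → ℝ

/-- One machine, which leaves the start-depot at time `0`, can perform operations of lengths `p` at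
the starting times `s`: it has time to reach every job from the start-depot, and of any two jobs
one is completed early enough for the machine to travel to the other one in time. -/
def Problem.MachineFeasible (P : Problem g) (p s : Fin P.n → ℝ) : Prop :=
  (∀ j, P.dist .start (.job (P.loc j)) ≤ s j) ∧
  ∀ j k, j ≠ k → s j + p j + P.travel j k ≤ s k ∨ s k + p k + P.travel k j ≤ s j

/-- Feasible schedules: both machines are able to follow the schedule, and no job is started on
machine `B` before it is completed on machine `A`. -/
def Schedule.Feasible {P : Problem g} (S : Schedule P) : Prop :=
  P.MachineFeasible P.a S.startA ∧ P.MachineFeasible P.b S.startB ∧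
  ∀ j, S.startA j + P.a j ≤ S.startB j

/-- The objective function: the time at which machine `B`, having completed all the jobs, arrives
at the finish-depot. (The machine travels there directly from its last job; by the triangle
inequality the maximum below is attained at the last job.) -/
noncomputable def Schedule.makespan {P : Problem g} (S : Schedule P) : ℝ :=
  ⨆ j, (S.startB j + P.b j + P.dist (.job (P.loc j)) .finish)

/-- Optimal schedules: feasible, with minimum makespan among all feasible schedules. -/
def Schedule.IsOptimal {P : Problem g} (S : Schedule P) : Prop :=
  S.Feasible ∧ ∀ S' : Schedule P, S'.Feasible → S.makespan ≤ S'.makespan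

/-- The priority vector of a job, in the lexicographically ordered product. -/
noncomputable def Problem.priority (P : Problem g) (j : Fin P.n) : ℕ ×ₗ ℝ ×ₗ Fin P.n :=
  if P.a j ≤ P.b j then toLex (1, toLex (P.a j, j)) else toLex (2, toLex (-P.b j, j))

/-- The strict linear order of the jobs given by Johnson's rule. -/
def Problem.Prec (P : Problem g) (j k : Fin P.n) : Prop :=
  P.priority j < P.priority k

/-! ### Computations with a step count

The algorithm is a program for a random access machine with exact real arithmetic at unit cost.
A program is a term of type `Timed α`: it has a result and the number of elementary steps made.
The steps of the parts of a program are added up. Each arithmetic operation, each comparison, each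
access to a memory cell (of the input, or of an array with one index) and each creation of a list
cell is one step (`op`); the beginning of a call of a recursive procedure, including the inspection
of its list argument, and each iteration of a loop are one step as well (`tick`).

Arrays are represented by functions, and assignment to a cell by `Function.update`; an access to
the array with `g + 1` indices costs `g + 1` steps. Copying an array of `k` cells, or filling it with
initial values, costs `k` steps; the unused cells of the table of lists are not initialised. -/

structure Timed (α : Type) : Type where
  val : α
  steps : ℕ

instance : Monad Timed where
  pure x := ⟨x, 0⟩
  bind x f := ⟨(f x.val).val, x.steps + (f x.val).steps⟩

/-- A result obtained in `c` elementary steps. -/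
def charge {α : Type} (c : ℕ) (x : α) : Timed α := ⟨x, c⟩

/-- One elementary operation with result `x`. -/
def op {α : Type} (x : α) : Timed α := charge 1 x

def tick : Timed Unit := op ()

/-- The loop over the elements `x` of a list, in the order of the list; `s` is the loop state. -/
def forEach {α σ : Type} (body : α → σ → Timed σ) : List α → σ → Timed σ
  | [], s => do
    tick
    return s
  | x :: xs, s => do
    tick
    let s ← body x s
    forEach body xs s

/-- The loop over `c = 0, 1, …, n - 1`. -/
def forUp {σ : Type} (n : ℕ) (body : ℕ → σ → Timed σ) (s : σ) : Timed σ :=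
  forEach body (List.range n) s

/-- Puts the elements of a list, one after the other, in front of another list. -/
def rewind {α : Type} : List α → List α → Timed (List α)
  | [], l => do
    tick
    return l
  | x :: xs, l => do
    tick
    let l ← op (x :: l)
    rewind xs l

/-- The first `k` elements of a list, in reversed order, in front of `acc`. -/
def takeRev {α : Type} : ℕ → List α → List α → Timed (List α)
  | 0, _, acc => do
    tick
    return acc
  | _ + 1, [], acc => do
    tick
    return acc
  | k + 1, x :: xs, acc => do
    tick
    let acc ← op (x :: acc)
    takeRev k xs acc

/-! ### Numbering the jobs of each node properly -/

open Classical in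
/-- Inserts a job into a list sorted by Johnson's rule. Evaluating two priority vectors (four
accesses, two comparisons, two changes of sign) and comparing them lexicographically (at most five
comparisons) takes at most 13 steps. -/
noncomputable def insertJob (P : Problem g) (j : Fin P.n) :
    List (Fin P.n) → Timed (List (Fin P.n))
  | [] => do
    tick
    op [j]
  | k :: ks => do
    tick
    if (← charge 13 (decide (P.Prec j k))) then
      op (j :: k :: ks)
    else
      let l ← insertJob P j ks
      op (k :: l)

/-- For each job node the list of its jobs, in the ascending order of `Prec`. -/
noncomputable def sortJobs (P : Problem g) : Timed (Fin g → List (Fin P.n)) := do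
  let J ← charge g (fun _ => [])
  forEach (fun j J => do
    let i ← op (P.loc j)
    let l ← op (J i)
    let l ← insertJob P j l
    op (Function.update J i l)) (List.finRange P.n) J

/-- The numbers of jobs located at the job nodes. -/
noncomputable def countJobs (P : Problem g) : Timed (Fin g → ℕ) := do
  let N ← charge g (fun _ => 0)
  forEach (fun j N => do
    let i ← op (P.loc j)
    let c ← op (N i)
    let c ← op (c + 1)
    op (Function.update N i c)) (List.finRange P.n) N

/-! ### Lists of solutions -/

/-- A solution for a configuration: the completion times `f1`, `f2` of the jobs of the configuration
by the machines `A` and `B`, and the steps `(i, d)` ("`d` jobs at node `i`") of the process that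
led to them, the last one first, so that the schedule can be restored. -/
structure Sol (g : ℕ) where
  f1 : ℝ
  f2 : WithTop ℝ
  route : List (Fin g × ℕ)

/-- The dummy solution `(0, ∞)`. -/
def dummySol : Sol g := ⟨0, ⊤, []⟩

/-- The only solution for the initial configuration. -/
def initialSol : Sol g := ⟨0, 0, []⟩

/-- A list of solutions with a pointer to its current control element `ctrl`. The elements that
precede `ctrl` are kept in `left`, the nearest one first; those that follow it, in `right`. -/
structure Zipper (g : ℕ) where
  left : List (Sol g)
  ctrl : Sol g
  right : List (Sol g)

/-- Moves the control element to the last solution with `f1 ≤ x`. -/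
noncomputable def advance (x : ℝ) : List (Sol g) → Sol g → List (Sol g) → Timed (Zipper g)
  | L, c, [] => do
    tick
    return ⟨L, c, []⟩
  | L, c, s :: R => do
    tick
    if (← op (decide (s.f1 ≤ x))) then
      let L ← op (c :: L)
      advance x L s R
    else
      return ⟨L, c, s :: R⟩

/-- Removes solutions with `y ≤ f2` from the beginning of a list. -/
noncomputable def dropMajorized (y : WithTop ℝ) : List (Sol g) → Timed (List (Sol g))
  | [] => do
    tick
    return []
  | s :: R => do
    tick
    if (← op (decide (y ≤ s.f2))) then
      dropMajorized y R
    else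
      return s :: R

/-- Finds the control element for the applicant `s`. If it does not majorize the applicant,
removes the solutions majorized by the applicant, includes the applicant in the list and makes it
the new control element. -/
noncomputable def offer (s : Sol g) (z : Zipper g) : Timed (Zipper g) := do
  let z ← advance s.f1 z.left z.ctrl z.right
  if (← op (decide (z.ctrl.f2 ≤ s.f2))) then
    return z
  else
    let R ← dropMajorized s.f2 z.right
    if (← op (decide (z.ctrl.f1 = s.f1))) then
      return ⟨z.left, s, R⟩
    else
      let L ← op (z.ctrl :: z.left)
      return ⟨L, s, R⟩

/-! ### One step of the loop on pre-configurations -/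

/-- Characteristics of an optimal schedule for a two-machine flow shop without travel: the workloads
`l1`, `l2` of the machines and the length `c` of the schedule. -/
structure Block where
  l1 : ℝ
  l2 : ℝ
  c : ℝ

/-- The characteristics after adding one more job at the beginning of the processing order. -/
noncomputable def prependJob (P : Problem g) (j : Fin P.n) (B : Block) : Timed Block := do
  let x ← op (P.a j)
  let y ← op (P.b j)
  let l1 ← op (x + B.l1)
  let l2 ← op (y + B.l2)
  let m ← op (max B.c l2)
  let c ← op (x + m)
  return ⟨l1, l2, c⟩

/-- The loop on the solutions of a pre-configuration. It forms the solutions obtained by going to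
node `i` (travel time `r`) and performing there `d` jobs with characteristics `B`,
where `δ = B.c - B.l2`. The condition `f1 + δ ≤ f2` means `f2 - f1 ≥ δ`; after the first solution
for which it fails, the loop is stopped. -/
noncomputable def scan (i : Fin g) (d : ℕ) (r : ℝ) (B : Block) (δ : ℝ) :
    List (Sol g) → Zipper g → Timed (Zipper g)
  | [], z => do
    tick
    return z
  | s :: ss, z => do
    tick
    let t ← op (s.f1 + r)
    let x ← op (t + B.l1)
    let rt ← op ((i, d) :: s.route)
    let u ← op (s.f1 + δ)
    if (← op (decide ((u : WithTop ℝ) ≤ s.f2))) then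
      let v ← op (s.f2 + (r : WithTop ℝ))
      let y ← op (v + (B.l2 : WithTop ℝ))
      let z ← offer ⟨x, y, rt⟩ z
      scan i d r B δ ss z
    else
      let y ← op (t + B.c)
      offer ⟨x, (y : WithTop ℝ), rt⟩ z

/-- Adjusts the current (nonempty) list of solutions of a configuration, the second argument, using
the solutions of a pre-configuration, the first one. -/
noncomputable def adjust (i : Fin g) (d : ℕ) (r : ℝ) (B : Block) (δ : ℝ) (Fpre : List (Sol g)) :
    List (Sol g) → Timed (List (Sol g))
  | [] => do
    tick
    return []
  | c :: R => do
    tick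
    let z ← scan i d r B δ Fpre ⟨[], c, R⟩
    let l ← op (z.ctrl :: z.right)
    rewind z.left l

/-! ### The main stage -/

/-- The array of the lists of solutions of all basic configurations `(K, i)`. -/
abbrev Table (g : ℕ) : Type := (Fin g → ℕ) → Fin g → List (Sol g)

/-- The loop on the number `d` of jobs performed at node `i` in the last step, with the inner loop
on the previous node. The list argument holds the jobs of node `i` that are not yet
in the block, in the descending order; `K`, `m` are the vector of the pre-configuration and its norm,
`B` and `d` describe the block, and `F` is the current list of solutions (each of these before the
next job is added to the block). -/
noncomputable def loopD (P : Problem g) (T : Table g) (i : Fin g) :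
    List (Fin P.n) → (Fin g → ℕ) → ℕ → ℕ → Block → List (Sol g) → Timed (List (Sol g))
  | [], _, _, _, _, F => do
    tick
    return F
  | j :: js, K, m, d, B, F => do
    tick
    let B ← prependJob P j B
    let δ ← op (B.c - B.l2)
    let k ← op (K i)
    let k ← op (k - 1)
    let K ← op (Function.update K i k)
    let m ← op (m - 1)
    let d ← op (d + 1)
    let F ←
      if (← op (decide (m = 0))) then do
        let r ← op (P.dist .start (.job i))
        let Fpre ← op [initialSol]
        adjust i d r B δ Fpre F
      else
        pure F
    let F ← forEach (fun i' F => do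
      let k' ← op (K i')
      if (← op (decide (i' ≠ i))) && (← op (decide (0 < k'))) then
        let Fpre ← charge (g + 1) (T K i')
        let r ← op (P.dist (.job i') (.job i))
        adjust i d r B δ Fpre F
      else
        return F) (List.finRange g) F
    loopD P T i js K m d B F

/-- Creates the list of solutions for the basic configuration `(K, i)`, where `m` is the norm
of `K`, starting from the list that consists of the dummy solution. -/
noncomputable def solveConfig (P : Problem g) (J : Fin g → List (Fin P.n)) (T : Table g)
    (K : Fin g → ℕ) (m : ℕ) (i : Fin g) : Timed (List (Sol g)) := do
  let k ← op (K i)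
  let l ← op (J i)
  let K ← charge g K
  let js ← takeRev k l []
  let F ← op [dummySol]
  loopD P T i js K m 0 ⟨0, 0, 0⟩ F

/-- Nested loops over the given coordinates: assigns to them all values `0, …, N i`, in the
lexicographically ascending order; `m` is the sum of the values assigned so far. -/
def forBox {σ : Type} (N : Fin g → ℕ) (body : (Fin g → ℕ) → ℕ → σ → Timed σ) :
    List (Fin g) → (Fin g → ℕ) → ℕ → σ → Timed σ
  | [], K, m, s => do
    tick
    body K m s
  | i :: is, K, m, s => do
    tick
    let u ← op (N i)
    let u ← op (u + 1)
    forUp u (fun c s => do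
      let K ← op (Function.update K i c)
      let m ← op (m + c)
      forBox N body is K m s) s

/-- The main stage: for `k = 1, …, n` the vectors `K` of norm `k` are enumerated in lexicographical
order, and for each of them those nodes `i` for which `0 < K i`. -/
noncomputable def mainStage (P : Problem g) (J : Fin g → List (Fin P.n)) (N : Fin g → ℕ) :
    Timed (Table g) :=
  forUp P.n (fun k T => do
    let k ← op (k + 1)
    let K ← charge g (fun _ => 0)
    forBox N (fun K m T => do
      if (← op (decide (m = k))) then
        forEach (fun i T => do
          let c ← op (K i)
          if (← op (decide (0 < c))) then
            let F ← solveConfig P J T K m i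
            charge (g + 1) (Function.update T K (Function.update (T K) i F))
          else
            return T) (List.finRange g) T
      else
        return T) (List.finRange g) K 0 T) (fun _ _ => [])

/-! ### The final stage -/

/-- The last element of a list (`s` if the list is empty). -/
def lastSol : Sol g → List (Sol g) → Timed (Sol g)
  | s, [] => do
    tick
    return s
  | _, t :: ts => do
    tick
    lastSol t ts

/-- Chooses the best one among the `g` variants of the last visited job node. The result is the
value of the objective function and the steps of the process, the last one first. -/
noncomputable def finalStage (P : Problem g) (T : Table g) (N : Fin g → ℕ) :
    Timed (WithTop ℝ × List (Fin g × ℕ)) :=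
  forEach (fun i best => do
    let F ← charge (g + 1) (T N i)
    let s ← lastSol dummySol F
    let r ← op (P.dist (.job i) .finish)
    let v ← op (s.f2 + (r : WithTop ℝ))
    if (← op (decide (v < best.1))) then
      return (v, s.route)
    else
      return best) (List.finRange g) (⊤, [])

/-- State of the restoration of a schedule: current node and current times of the machines, the
remaining jobs of each node, the starting times found so far. -/
structure Replay (P : Problem g) where
  pos : Node g
  tA : ℝ
  tB : ℝ
  rest : Fin g → List (Fin P.n)
  sched : Schedule P

/-- Performs the next `d` jobs of the list `rest i`, each operation as early as possible. -/
noncomputable def replayJobs (P : Problem g) (i : Fin g) : ℕ → Replay P → Timed (Replay P)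
  | 0, R => do
    tick
    return R
  | d + 1, R => do
    tick
    let l ← op (R.rest i)
    match l with
    | [] => return R
    | j :: js => do
      let rest ← op (Function.update R.rest i js)
      let x ← op (P.a j)
      let y ← op (P.b j)
      let fA ← op (R.tA + x)
      let sB ← op (max R.tB fA)
      let fB ← op (sB + y)
      let SA ← op (Function.update R.sched.startA j R.tA)
      let SB ← op (Function.update R.sched.startB j sB)
      replayJobs P i d ⟨R.pos, fA, fB, rest, ⟨SA, SB⟩⟩

/-- Restores the (permutation) schedule from the steps of the process, the last one first. -/
noncomputable def restore (P : Problem g) (J : Fin g → List (Fin P.n))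
    (route : List (Fin g × ℕ)) : Timed (Schedule P) := do
  let steps ← rewind route []
  let S ← charge P.n (⟨fun _ => 0, fun _ => 0⟩ : Schedule P)
  let R ← forEach (fun (p : Fin g × ℕ) (R : Replay P) => do
    let r ← op (P.dist R.pos (.job p.1))
    let tA ← op (R.tA + r)
    let tB ← op (R.tB + r)
    replayJobs P p.1 p.2 ⟨.job p.1, tA, tB, R.rest, R.sched⟩) steps ⟨.start, 0, 0, J, S⟩
  return R.sched

/-! ### The algorithm -/

structure Output (P : Problem g) where
  value : WithTop ℝ
  schedule : Schedule P

/-- The dynamic programming algorithm. -/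
noncomputable def algDP (P : Problem g) : Timed (Output P) := do
  let J ← sortJobs P
  let N ← countJobs P
  let T ← mainStage P J N
  let best ← finalStage P T N
  let S ← restore P J best.2
  return ⟨best.1, S⟩

end RoutingFlowShop

/-! If both machines perform the jobs in one common sequence, they follow the same route, so travel
delays both equally. The last job is then completed on machine B at the travel-free flow shop
makespan `flow` plus the travel time, and the objective value is `cost`. The proof shows that such
sequences suffice, that each node may be served in Johnson's order, and that the dynamic program
searches all the sequences that remain.

Common sequences suffice (`exists_cost_le_makespan`). Let a feasible schedule use the orders π on A
and σ on B. For every job j the makespan is at least the A-work of π through j, plus the B-work of σ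
from j on, plus the travel along these two pieces. On the other side, `flow` of a sequence is the
maximum over critical jobs i of the A-work through i plus the B-work from i on.
`exists_common_order` merges π and σ into one sequence τ in which every i is dominated by some j, in
both workloads and in travel.

Johnson's order (`exists_sorted_perm`). If two jobs at one node stand in the wrong order, either the
later one can be moved directly before the earlier one, or the earlier one directly behind the later
one. Neither move increases `flow` (`flow_pull`, `flow_push`), and the triangle inequality keeps the
tour from growing (`tour_pull`, `tour_push`). So only sequences that perform initial segments of the
sorted lists matter; `Reaches` describes them.

Dynamic programming. A sequence ending at node i splits into a shorter one ending elsewhere and a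
nonempty block at i (`exists_last_block`). The new pair of completion times is a monotone function
of the old one, so Pareto-optimal pairs are enough (`adjust_correct`, `loopD_spec`,
`mainStage_spec`). Each stored pair carries its steps, and replaying them gives a feasible schedule
of exactly that value (`restore_spec`).

Running time. For fixed K the first coordinate of a pair depends only on the first node and on how
often each of the g² - g arcs is used, so a list has O(n^(g² - g)) entries (`Pareto.length_le`).
Merging two lists takes linear time, by an amortized count of pointer moves. With at most (n + 1)^g
vectors K and at most n block lengths, the exponent is g + 1 + (g² - g) = g² + 1. -/

namespace RoutingFlowShop

variable {g : ℕ}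

/-! ### Job sequences -/

namespace Problem

variable (P : Problem g)

/-- The node of a job. -/
def node (j : Fin P.n) : Node g := .job (P.loc j)

/-- The workload of machine `A`. -/
def asum (L : List (Fin P.n)) : ℝ := (L.map P.a).sum

/-- The workload of machine `B`. -/
def bsum (L : List (Fin P.n)) : ℝ := (L.map P.b).sum

/-- The flow shop makespan (without travel) of a job sequence. -/
noncomputable def flow : List (Fin P.n) → ℝ
  | [] => 0
  | x :: L => P.a x + max (flow L) (P.b x + P.bsum L)

/-- The travel time along a job sequence, starting from node `u`. -/
def trav : Node g → List (Fin P.n) → ℝ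
  | _, [] => 0
  | u, x :: L => P.dist u (P.node x) + trav (P.node x) L

/-- The last node of the walk along a job sequence, starting from node `u`. -/
def endNode : Node g → List (Fin P.n) → Node g
  | u, [] => u
  | _, x :: L => endNode (P.node x) L

/-- The travel time along a job sequence from node `u` to node `w`. -/
def tour (u : Node g) (L : List (Fin P.n)) (w : Node g) : ℝ :=
  P.trav u L + P.dist (P.endNode u L) w

/-- The value of the objective function for the permutation schedule given by a sequence. -/
noncomputable def cost (L : List (Fin P.n)) : ℝ := P.flow L + P.tour .start L .finish

@[simp] theorem asum_nil : P.asum [] = 0 := rfl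
@[simp] theorem bsum_nil : P.bsum [] = 0 := rfl
@[simp] theorem flow_nil : P.flow [] = 0 := rfl
@[simp] theorem trav_nil (u : Node g) : P.trav u [] = 0 := rfl
@[simp] theorem endNode_nil (u : Node g) : P.endNode u [] = u := rfl

@[simp] theorem asum_cons (x : Fin P.n) (L : List (Fin P.n)) :
    P.asum (x :: L) = P.a x + P.asum L := by simp [asum]

@[simp] theorem bsum_cons (x : Fin P.n) (L : List (Fin P.n)) :
    P.bsum (x :: L) = P.b x + P.bsum L := by simp [bsum]

@[simp] theorem flow_cons (x : Fin P.n) (L : List (Fin P.n)) :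
    P.flow (x :: L) = P.a x + max (P.flow L) (P.b x + P.bsum L) := rfl

@[simp] theorem trav_cons (u : Node g) (x : Fin P.n) (L : List (Fin P.n)) :
    P.trav u (x :: L) = P.dist u (P.node x) + P.trav (P.node x) L := rfl

@[simp] theorem endNode_cons (u : Node g) (x : Fin P.n) (L : List (Fin P.n)) :
    P.endNode u (x :: L) = P.endNode (P.node x) L := rfl

@[simp] theorem asum_append (L M : List (Fin P.n)) : P.asum (L ++ M) = P.asum L + P.asum M := by
  simp [asum]

@[simp] theorem bsum_append (L M : List (Fin P.n)) : P.bsum (L ++ M) = P.bsum L + P.bsum M := by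
  simp [bsum]

theorem asum_nonneg (L : List (Fin P.n)) : 0 ≤ P.asum L :=
  List.sum_nonneg (by simp only [List.mem_map]; rintro _ ⟨x, -, rfl⟩; exact P.a_nonneg x)

theorem asum_perm {L M : List (Fin P.n)} (h : L.Perm M) : P.asum L = P.asum M :=
  (h.map P.a).sum_eq

theorem bsum_perm {L M : List (Fin P.n)} (h : L.Perm M) : P.bsum L = P.bsum M :=
  (h.map P.b).sum_eq

theorem asum_le_of_sublist {L M : List (Fin P.n)} (h : L.Sublist M) : P.asum L ≤ P.asum M := by
  induction h with
  | slnil => simp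
  | cons x _ ih => simpa using by linarith [P.a_nonneg x]
  | cons_cons x _ ih => simpa using ih

theorem bsum_le_of_sublist {L M : List (Fin P.n)} (h : L.Sublist M) : P.bsum L ≤ P.bsum M := by
  induction h with
  | slnil => simp
  | cons x _ ih => simpa using by linarith [P.b_nonneg x]
  | cons_cons x _ ih => simpa using ih

theorem asum_le_of_subset {L M : List (Fin P.n)} (hL : L.Nodup) (h : L ⊆ M) :
    P.asum L ≤ P.asum M := by
  obtain ⟨L', hp, hs⟩ := hL.subperm h
  rw [← P.asum_perm hp]; exact P.asum_le_of_sublist hs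

theorem bsum_le_of_subset {L M : List (Fin P.n)} (hL : L.Nodup) (h : L ⊆ M) :
    P.bsum L ≤ P.bsum M := by
  obtain ⟨L', hp, hs⟩ := hL.subperm h
  rw [← P.bsum_perm hp]; exact P.bsum_le_of_sublist hs

theorem trav_nonneg (u : Node g) (L : List (Fin P.n)) : 0 ≤ P.trav u L := by
  induction L generalizing u with
  | nil => simp
  | cons x L ih => simpa using add_nonneg (P.dist_nonneg _ _) (ih _)

theorem endNode_append (u : Node g) (L M : List (Fin P.n)) :
    P.endNode u (L ++ M) = P.endNode (P.endNode u L) M := by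
  induction L generalizing u with
  | nil => simp
  | cons x L ih => simp [ih]

theorem trav_append (u : Node g) (L M : List (Fin P.n)) :
    P.trav u (L ++ M) = P.trav u L + P.trav (P.endNode u L) M := by
  induction L generalizing u with
  | nil => simp
  | cons x L ih => simp [ih, add_assoc]

@[simp] theorem tour_nil (u w : Node g) : P.tour u [] w = P.dist u w := by simp [tour]

@[simp] theorem tour_cons (u w : Node g) (x : Fin P.n) (L : List (Fin P.n)) :
    P.tour u (x :: L) w = P.dist u (P.node x) + P.tour (P.node x) L w := by simp [tour, add_assoc]

theorem tour_append_cons (u w : Node g) (x : Fin P.n) (L M : List (Fin P.n)) :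
    P.tour u (L ++ x :: M) w = P.tour u L (P.node x) + P.tour (P.node x) M w := by
  induction L generalizing u with
  | nil => simp
  | cons y L ih => simp [ih, add_assoc]

theorem tour_le_dist_add (u v w : Node g) (L : List (Fin P.n)) :
    P.tour u L w ≤ P.dist u v + P.tour v L w := by
  cases L with
  | nil => simpa using P.dist_triangle u v w
  | cons x L => simpa using by linarith [P.dist_triangle u v (P.node x)]

/-- Skipping a job replaces two legs of the walk by a direct one, so this is the triangle inequality
applied repeatedly. -/
theorem tour_le_of_sublist {L M : List (Fin P.n)} (h : L.Sublist M) (u w : Node g) :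
    P.tour u L w ≤ P.tour u M w := by
  induction h generalizing u with
  | slnil => simp
  | cons x _ ih =>
    simpa using (P.tour_le_dist_add u (P.node x) w _).trans (by gcongr; exact ih _)
  | cons_cons x _ ih => simpa using ih _

theorem asum_le_flow (L : List (Fin P.n)) : P.asum L ≤ P.flow L := by
  induction L with
  | nil => simp
  | cons x L ih => simpa using Or.inl ih

theorem bsum_le_flow (L : List (Fin P.n)) : P.bsum L ≤ P.flow L := by
  cases L with
  | nil => simp
  | cons x L =>
    have := P.a_nonneg x
    have := le_max_right (P.flow L) (P.b x + P.bsum L)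
    simp only [bsum_cons, flow_cons]; linarith

/-- The critical job lies either in `M`, preceded by all the A-work of `L`, or in `L`, followed by
all the B-work of `M`. -/
theorem flow_append (L M : List (Fin P.n)) :
    P.flow (L ++ M) = max (P.asum L + P.flow M) (P.flow L + P.bsum M) := by
  induction L with
  | nil => simpa using P.bsum_le_flow M
  | cons x L ih =>
    simp only [List.cons_append, flow_cons, ih, asum_cons, bsum_append]
    rw [add_assoc, add_assoc, ← max_add_add_left]
    rw [max_add_add_left, max_add_add_left, max_assoc, ← max_add_add_right, add_assoc]

/-- By `flow_append`, a middle segment enters only through its two workloads, which a permutation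
preserves, and monotonically through its own `flow`. Exchanges can therefore be judged locally. -/
theorem flow_mono {L M α β : List (Fin P.n)} (hp : L.Perm M) (hf : P.flow L ≤ P.flow M) :
    P.flow (α ++ L ++ β) ≤ P.flow (α ++ M ++ β) := by
  simp only [flow_append, asum_append, P.asum_perm hp, P.bsum_perm hp]
  gcongr

/-- `flow` is a longest path: A-work up to a critical job, then B-work from that job on. Bounding
every such path bounds `flow`. -/
theorem flow_le {L : List (Fin P.n)} (hL : L ≠ []) {t : ℝ}
    (h : ∀ L₁ i L₂, L = L₁ ++ i :: L₂ → P.asum (L₁ ++ [i]) + P.bsum (i :: L₂) ≤ t) :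
    P.flow L ≤ t := by
  induction L generalizing t with
  | nil => exact absurd rfl hL
  | cons x L ih =>
    have h0 := h [] x L rfl
    simp only [List.nil_append, asum_cons, asum_nil, bsum_cons] at h0
    rw [flow_cons]
    have : P.flow L ≤ t - P.a x := by
      rcases eq_or_ne L [] with rfl | hne
      · simp at h0 ⊢; linarith [P.b_nonneg x]
      · refine ih hne fun L₁ i L₂ e => ?_
        have := h (x :: L₁) i L₂ (by simp [e])
        simp only [List.cons_append, asum_cons] at this
        linarith
    have : max (P.flow L) (P.b x + P.bsum L) ≤ t - P.a x := max_le this (by linarith)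
    linarith

/-! ### Johnson's rule -/

theorem flow_pull {x k : Fin P.n} (h₁ : P.a k ≤ P.b k) (h₂ : P.a k ≤ P.a x)
    (M : List (Fin P.n)) : P.flow (k :: x :: M) ≤ P.flow (x :: (M ++ [k])) := by
  simp only [flow_cons, flow_append, bsum_append, bsum_cons, bsum_nil, flow_nil, add_zero]
  have := le_max_left (P.asum M + (P.a k + max 0 (P.b k))) (P.flow M + P.b k)
  have h3 := le_max_right (P.asum M + (P.a k + max 0 (P.b k))) (P.flow M + P.b k)
  set X := max (P.asum M + (P.a k + max 0 (P.b k))) (P.flow M + P.b k)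
  have h4 := le_max_left X (P.b x + (P.bsum M + P.b k))
  have h5 := le_max_right X (P.b x + (P.bsum M + P.b k))
  set Y := max X (P.b x + (P.bsum M + P.b k))
  have h6 : max (P.flow M) (P.b x + P.bsum M) ≤ Y - P.a k := max_le (by linarith) (by linarith)
  have h7 : max (P.a x + max (P.flow M) (P.b x + P.bsum M)) (P.b k + (P.b x + P.bsum M))
      ≤ P.a x + Y - P.a k := max_le (by linarith) (by linarith)
  linarith

theorem flow_push {x k : Fin P.n} (h₁ : P.b x ≤ P.a x) (h₂ : P.b x ≤ P.b k)
    (M : List (Fin P.n)) : P.flow (M ++ [k, x]) ≤ P.flow (x :: (M ++ [k])) := by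
  simp only [flow_cons, flow_append, bsum_append, bsum_cons, bsum_nil, flow_nil, add_zero,
    max_eq_right (P.b_nonneg _)]
  have h3 := le_max_left (P.asum M + (P.a k + P.b k)) (P.flow M + P.b k)
  have h4 := le_max_right (P.asum M + (P.a k + P.b k)) (P.flow M + P.b k)
  set X := max (P.asum M + (P.a k + P.b k)) (P.flow M + P.b k)
  have h5 := le_max_left X (P.b x + (P.bsum M + P.b k))
  set Y := max X (P.b x + (P.bsum M + P.b k))
  refine max_le ?_ (by linarith)
  have : max (P.a x + P.b x) (P.b k + P.b x) ≤ P.a x + P.b k := max_le (by linarith) (by linarith)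
  linarith

/-- The two alternatives are exactly the hypotheses of `flow_pull` and `flow_push`. This is all that
is used of Johnson's rule apart from its being a strict linear order. -/
theorem prec_cases {k x : Fin P.n} (h : P.Prec k x) :
    (P.a k ≤ P.b k ∧ P.a k ≤ P.a x) ∨ (P.b x ≤ P.a x ∧ P.b x ≤ P.b k) := by
  unfold Prec priority at h
  split_ifs at h with h1 h2 h2 <;> simp only [Prod.Lex.toLex_lt_toLex] at h
  · rcases h with h | ⟨_, h | ⟨h, _⟩⟩
    · omega
    · exact .inl ⟨h1, h.le⟩
    · exact .inl ⟨h1, h.le⟩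
  -- Mixed groups: `k` has `a ≤ b` and `x` has `b < a`. If `a x ≤ a k`, then `b x < a x ≤ a k ≤ b
  -- k`, which gives the second alternative.
  · rcases le_total (P.a k) (P.a x) with h3 | h3
    · exact .inl ⟨h1, h3⟩
    · exact .inr ⟨by linarith, by linarith⟩
  · rcases h with h | ⟨h, _⟩ <;> omega
  · rcases h with h | ⟨_, h | ⟨h, _⟩⟩
    · omega
    · exact .inr ⟨by linarith, by linarith⟩
    · exact .inr ⟨by linarith, by linarith⟩

theorem priority_injective : Function.Injective P.priority := by
  have h : ∀ j, (ofLex (ofLex (P.priority j)).2).2 = j := fun j => by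
    unfold priority; split_ifs <;> rfl
  exact fun j k e =>
    (h j).symm.trans ((congrArg (fun p => (ofLex (ofLex p).2).2) e).trans (h k))

theorem prec_trichotomy {j k : Fin P.n} (h : j ≠ k) : P.Prec j k ∨ P.Prec k j :=
  lt_or_gt_of_ne (P.priority_injective.ne h)

theorem Prec.trans {P : Problem g} {i j k : Fin P.n} (h : P.Prec i j) (h' : P.Prec j k) :
    P.Prec i k :=
  lt_trans (a := P.priority i) h h'

theorem not_prec_self (j : Fin P.n) : ¬ P.Prec j j := lt_irrefl (P.priority j)

/-- At each node the jobs are performed in the order given by Johnson's rule. -/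
def Sorted (L : List (Fin P.n)) : Prop :=
  L.Pairwise fun x y => P.loc x = P.loc y → P.Prec x y

theorem exists_first_prec (x : Fin P.n) (β : List (Fin P.n)) :
    (∀ k ∈ β, P.loc k ≠ P.loc x) ∨
    ∃ M k β', β = M ++ k :: β' ∧ P.loc k = P.loc x ∧ ∀ m ∈ M, P.loc m ≠ P.loc x := by
  induction β with
  | nil => simp
  | cons y β ih =>
    by_cases hy : P.loc y = P.loc x
    · exact .inr ⟨[], y, β, rfl, hy, by simp⟩
    · rcases ih with h | ⟨M, k, β', rfl, hk, hM⟩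
      · exact .inl (by simpa [hy] using h)
      · exact .inr ⟨y :: M, k, β', rfl, hk, by simpa [hy] using hM⟩

/-- Placed next to `x`, the job `k` costs no travel because both are at one node; what is left is a
subsequence of the original sequence. -/
theorem tour_pull (α M β : List (Fin P.n)) {x k : Fin P.n} (h : P.loc k = P.loc x) :
    P.tour .start (α ++ k :: x :: (M ++ β)) .finish ≤
      P.tour .start (α ++ x :: (M ++ k :: β)) .finish := by
  have hn : P.node k = P.node x := by simp [node, h]
  calc P.tour .start (α ++ k :: x :: (M ++ β)) .finish
      = P.tour .start (α ++ x :: (M ++ β)) .finish := by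
        rw [tour_append_cons, tour_append_cons, tour_cons, hn, P.dist_self, zero_add]
    _ ≤ _ := P.tour_le_of_sublist (by simp) _ _

theorem tour_push (α M β : List (Fin P.n)) {x k : Fin P.n} (h : P.loc k = P.loc x) :
    P.tour .start (α ++ M ++ k :: x :: β) .finish ≤
      P.tour .start (α ++ x :: (M ++ k :: β)) .finish := by
  have hn : P.node k = P.node x := by simp [node, h]
  calc P.tour .start (α ++ M ++ k :: x :: β) .finish
      = P.tour .start (α ++ (M ++ k :: β)) .finish := by
        rw [← List.append_assoc, tour_append_cons, tour_append_cons, tour_cons, hn, P.dist_self,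
          zero_add]
    _ ≤ _ := P.tour_le_of_sublist (by simp) _ _

/-- Only the first job `k` of `β` at the node of `x` has to be compared with `x`. If `k` should
precede `x`, a pull or a push makes them adjacent in the right order, and `x` remains to be inserted
into a strictly shorter rest. The prefix `α` collects what is already settled, so that costs are
always compared for whole sequences. -/
theorem exists_sorted_insert (x : Fin P.n) (m : ℕ) : ∀ (α β : List (Fin P.n)), β.length ≤ m →
    x ∉ β → P.Sorted β → ∃ γ, γ.Perm (x :: β) ∧ P.Sorted γ ∧ P.cost (α ++ γ) ≤ P.cost (α ++ x :: β) := by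
  induction m with
  | zero =>
    intro α β hl hx hβ
    obtain rfl : β = [] := by simpa using hl
    exact ⟨[x], .refl _, by simp [Sorted], le_rfl⟩
  | succ m ih =>
    intro α β hl hx hβ
    rcases P.exists_first_prec x β with h | ⟨M, k, β', rfl, hk, hM⟩
    · exact ⟨x :: β, .refl _, List.pairwise_cons.2 ⟨fun y hy e => absurd e.symm (h y hy), hβ⟩, le_rfl⟩
    have hβ2 := List.pairwise_append.1 hβ
    have hβ3 := List.pairwise_cons.1 hβ2.2.1
    by_cases hkx : P.Prec k x
    · rcases P.prec_cases hkx with ⟨h1, h2⟩ | ⟨h1, h2⟩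
      · obtain ⟨γ, hp, hs, hc⟩ := ih (α ++ [k]) (M ++ β') (by simp at hl ⊢; omega)
          (by simp at hx ⊢; tauto) (hβ.sublist (by simp))
        refine ⟨k :: γ, ?_, List.pairwise_cons.2 ⟨fun y hy e => ?_, hs⟩, ?_⟩
        · refine (hp.cons k).trans ((List.Perm.swap _ _ _).trans (.cons _ List.perm_middle.symm))
        · have hy := hp.subset hy
          simp only [List.mem_cons, List.mem_append] at hy
          rcases hy with rfl | hy | hy
          · exact hkx
          · exact absurd (e.symm.trans hk) (hM y hy)
          · exact hβ3.1 y hy e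
        · have hf := P.flow_mono (α := α) (β := β') (L := k :: x :: M) (M := x :: (M ++ [k]))
            ((List.Perm.swap _ _ _).trans (.cons _ (List.perm_append_singleton _ _).symm))
            (P.flow_pull h1 h2 M)
          have ht := P.tour_pull α M β' hk
          simp only [List.append_assoc, List.cons_append, List.nil_append] at hf hc ⊢
          simp only [cost] at hc ⊢
          linarith
      · obtain ⟨γ, hp, hs, hc⟩ := ih (α ++ M ++ [k]) β' (by simp at hl ⊢; omega)
          (by simp at hx ⊢; tauto) (hβ.sublist (by simp))
        refine ⟨M ++ k :: γ, ?_, ?_, ?_⟩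
        · refine List.Perm.trans ?_ (List.perm_middle (l₁ := M) (a := x) (l₂ := k :: β'))
          exact .append_left _ ((hp.cons k).trans (.swap _ _ _))
        · refine List.pairwise_append.2 ⟨hβ2.1, List.pairwise_cons.2 ⟨fun y hy e => ?_, hs⟩, ?_⟩
          · have hy := hp.subset hy
            simp only [List.mem_cons] at hy
            rcases hy with rfl | hy
            · exact hkx
            · exact hβ3.1 y hy e
          · intro y hy z hz e
            simp only [List.mem_cons] at hz
            rcases hz with rfl | hz
            · exact hβ2.2.2 y hy z (by simp) e
            · have hz := hp.subset hz
              simp only [List.mem_cons] at hz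
              rcases hz with rfl | hz
              · exact absurd e (hM y hy)
              · exact hβ2.2.2 y hy z (by simp [hz]) e
        · have hf := P.flow_mono (α := α) (β := β') (L := M ++ [k, x]) (M := x :: (M ++ [k]))
            (((List.Perm.swap x k []).append_left M).trans List.perm_middle) (P.flow_push h1 h2 M)
          have ht := P.tour_push α M β' hk
          simp only [List.append_assoc, List.cons_append, List.nil_append] at hf hc ht ⊢
          simp only [cost] at hc ⊢
          linarith
    · refine ⟨_, .refl _, List.pairwise_cons.2 ⟨fun y hy e => ?_, hβ⟩, le_rfl⟩
      have hxk : P.Prec x k :=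
        (P.prec_trichotomy (by rintro rfl; simp at hx)).resolve_right hkx
      simp only [List.mem_append, List.mem_cons] at hy
      rcases hy with hy | rfl | hy
      · exact absurd e.symm (hM y hy)
      · exact hxk
      · exact hxk.trans (hβ3.1 y hy (hk.trans e))

theorem exists_sorted_perm (L : List (Fin P.n)) (hL : L.Nodup) :
    ∃ L', L'.Perm L ∧ P.Sorted L' ∧ P.cost L' ≤ P.cost L := by
  suffices h : ∀ β : List (Fin P.n), β.Nodup → ∀ α,
      ∃ γ, γ.Perm β ∧ P.Sorted γ ∧ P.cost (α ++ γ) ≤ P.cost (α ++ β) from h L hL []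
  intro β
  induction β with
  | nil => exact fun _ α => ⟨[], .refl _, by simp [Sorted], le_rfl⟩
  | cons x β ih =>
    intro hβ α
    rw [List.nodup_cons] at hβ
    obtain ⟨γ, hp, hs, hc⟩ := ih hβ.2 (α ++ [x])
    obtain ⟨δ, hp', hs', hc'⟩ := P.exists_sorted_insert x γ.length α γ le_rfl
      (fun h => hβ.1 (hp.subset h)) hs
    exact ⟨δ, hp'.trans (hp.cons x), hs', hc'.trans (by simpa using hc)⟩

end Problem
end RoutingFlowShop

namespace RoutingFlowShop

variable {g : ℕ}

/-! ### The lower bound -/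

namespace Problem

variable (P : Problem g)

/-- A machine can perform `j` and then `k`. -/
def Before (p s : Fin P.n → ℝ) (j k : Fin P.n) : Prop := s j + p j + P.travel j k ≤ s k

theorem Before.trans {P : Problem g} {p s : Fin P.n → ℝ} (hp : ∀ j, 0 ≤ p j) {i j k : Fin P.n}
    (h : P.Before p s i j) (h' : P.Before p s j k) : P.Before p s i k := by
  have := P.dist_triangle (.job (P.loc i)) (.job (P.loc j)) (.job (P.loc k))
  have := hp j
  unfold Before travel at *
  linarith

/-- On distinct jobs `Before` is total by feasibility and transitive by the triangle inequality, so
the jobs can be sorted by its reflexive closure; the absence of duplicates then removes the equality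
case. -/
theorem MachineFeasible.exists_order {P : Problem g} {p s : Fin P.n → ℝ}
    (h : P.MachineFeasible p s) (hp : ∀ j, 0 ≤ p j) :
    ∃ L : List (Fin P.n), L.Nodup ∧ (∀ j, j ∈ L) ∧ L.Pairwise (P.Before p s) := by
  classical
  let r : Fin P.n → Fin P.n → Prop := fun j k => j = k ∨ P.Before p s j k
  have : Std.Total r := ⟨fun j k => by
    by_cases hjk : j = k
    · exact .inl (.inl hjk)
    · exact (h.2 j k hjk).imp .inr .inr⟩
  have : IsTrans (Fin P.n) r := ⟨fun i j k hij hjk => by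
    rcases hij with rfl | hij
    · exact hjk
    · rcases hjk with rfl | hjk
      · exact .inr hij
      · exact .inr (hij.trans hp hjk)⟩
  have hperm := List.perm_insertionSort r (List.finRange P.n)
  have hn := hperm.nodup_iff.2 (List.nodup_finRange P.n)
  refine ⟨_, hn, fun j => hperm.mem_iff.2 (List.mem_finRange j), ?_⟩
  exact (List.Pairwise.and (List.pairwise_insertionSort r (List.finRange P.n)) hn).imp
    fun h => h.1.resolve_left h.2

/-- Here `c` is a time before which the machine cannot leave `u`. Each job of the list advances the
clock and the position, which is why both are generalized in the induction. -/
theorem add_tour_le_start {p s : Fin P.n → ℝ} {c : ℝ} {u : Node g} {L : List (Fin P.n)}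
    {j : Fin P.n} (h0 : ∀ k ∈ L ++ [j], c + P.dist u (P.node k) ≤ s k)
    (h : (L ++ [j]).Pairwise (P.Before p s)) :
    c + (L.map p).sum + P.tour u L (P.node j) ≤ s j := by
  induction L generalizing c u with
  | nil => simpa using h0
  | cons x L ih =>
    rw [List.cons_append, List.pairwise_cons] at h
    have h1 := h0 x (by simp)
    have := ih (c := c + P.dist u (P.node x) + p x) (u := P.node x) (fun k hk => by
      have h2 := h.1 k hk
      unfold Before travel at h2
      unfold node at h1 ⊢
      linarith) h.2
    simp only [List.map_cons, List.sum_cons, tour_cons]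
    linarith

theorem start_add_tour_le {p s : Fin P.n → ℝ} {t : ℝ} {w : Node g} {L : List (Fin P.n)}
    {j : Fin P.n} (h0 : ∀ k, s k + p k + P.dist (P.node k) w ≤ t)
    (h : (j :: L).Pairwise (P.Before p s)) :
    s j + p j + (L.map p).sum + P.tour (P.node j) L w ≤ t := by
  induction L generalizing j with
  | nil => simpa using h0 j
  | cons x L ih =>
    rw [List.pairwise_cons] at h
    have h2 := h.1 x (by simp)
    have := ih h.2
    unfold Before travel at h2
    unfold node at *
    simp only [List.map_cons, List.sum_cons, tour_cons]
    unfold node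
    linarith

end Problem

/-! ### Positions in duplicate-free lists -/

section Order

variable {α : Type*} [DecidableEq α] {L : List α}

theorem pairwise_idxOf (h : L.Nodup) : L.Pairwise fun x y => L.idxOf x < L.idxOf y := by
  rw [List.pairwise_iff_getElem]
  intro i j hi hj hij
  rwa [h.idxOf_getElem, h.idxOf_getElem]

theorem mem_drop_iff_le_idxOf (h : L.Nodup) {x : α} (hx : x ∈ L) {m : ℕ} :
    x ∈ L.drop m ↔ m ≤ L.idxOf x := by
  rw [← not_lt, ← List.mem_take_iff_idxOf_lt hx]
  rw [← List.take_append_drop m L] at h hx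
  have hd := (List.nodup_append.1 h).2.2
  constructor
  · intro h1 h2
    exact hd x h2 x h1 rfl
  · exact (List.mem_append.1 hx).resolve_left

theorem take_idxOf_succ {x : α} (hx : x ∈ L) :
    L.take (L.idxOf x + 1) = L.take (L.idxOf x) ++ [x] := by
  rw [List.take_succ_eq_append_getElem (List.idxOf_lt_length_of_mem hx), List.getElem_idxOf]

theorem drop_idxOf {x : α} (hx : x ∈ L) :
    L.drop (L.idxOf x) = x :: L.drop (L.idxOf x + 1) := by
  rw [List.drop_eq_getElem_cons (List.idxOf_lt_length_of_mem hx), List.getElem_idxOf]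

end Order

/-! ### Merging the orders of the two machines into one sequence -/

namespace Problem

variable (P : Problem g)

/-- Call `j` covering if the π-prefix through `j` and the σ-suffix from `j` together contain all
jobs. The sequence `τ` is built from the covering job `k` with the shortest tour. Any `j` that
dominates a critical job of `τ` is itself covering, so its tour is at least the tour used for `τ`.
-/
theorem exists_common_order {π σ : List (Fin P.n)} (hn : 0 < P.n) (hπ : π.Nodup) (hσ : σ.Nodup)
    (hπm : ∀ j, j ∈ π) (hσm : ∀ j, j ∈ σ) :
    ∃ τ : List (Fin P.n), τ.Nodup ∧ (∀ j, j ∈ τ) ∧ ∀ τ₁ i τ₂, τ = τ₁ ++ i :: τ₂ →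
      ∃ j, τ₁ ++ [i] ⊆ π.take (π.idxOf j + 1) ∧ i :: τ₂ ⊆ σ.drop (σ.idxOf j) ∧
        P.tour .start τ .finish ≤
          P.tour .start (π.take (π.idxOf j + 1) ++ σ.drop (σ.idxOf j + 1)) .finish := by
  classical
  have hpt : ∀ {x m}, x ∈ π.take m ↔ π.idxOf x < m := List.mem_take_iff_idxOf_lt (hπm _)
  have hqd : ∀ {x m}, x ∈ σ.drop m ↔ m ≤ σ.idxOf x := mem_drop_iff_le_idxOf hσ (hσm _)
  have hpi : ∀ {x y}, π.idxOf x = π.idxOf y → x = y := fun {x y} h => (List.idxOf_inj (hπm x)).1 h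
  have hqi : ∀ {x y}, σ.idxOf x = σ.idxOf y → x = y := fun {x y} h => (List.idxOf_inj (hσm x)).1 h
  set p := fun x => π.idxOf x with hp
  set q := fun x => σ.idxOf x with hq
  let E : Finset (Fin P.n) := Finset.univ.filter fun j => ∀ x, p x ≤ p j ∨ q j ≤ q x
  -- The last job of π is covering.
  have hE : E.Nonempty := by
    obtain ⟨j, -, hj⟩ := Finset.exists_max_image Finset.univ p ⟨⟨0, hn⟩, Finset.mem_univ _⟩
    exact ⟨j, by simpa [E] using fun x => Or.inl (hj x (Finset.mem_univ x))⟩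
  obtain ⟨k, hkE, hk⟩ := Finset.exists_min_image E (fun j =>
    P.tour .start (π.take (p j + 1) ++ σ.drop (q j + 1)) .finish) hE
  replace hkE : ∀ x, p x ≤ p k ∨ q k ≤ q x := by simpa [E] using hkE
  -- Up to `k` the order is that of π; the remaining jobs follow in the order of σ. They all come
  -- after `k` in σ because `k` is covering.
  let τ := π.take (p k + 1) ++ (σ.drop (q k + 1)).filter (fun x => p k < p x)
  have hτm : ∀ j, j ∈ τ := by
    intro j
    simp only [τ, List.mem_append, List.mem_filter, decide_eq_true_eq, hpt, hqd]
    by_cases h : p j ≤ p k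
    · exact .inl (by simp only [hp] at h ⊢; omega)
    · refine .inr ⟨?_, by omega⟩
      have h1 := (hkE j).resolve_left h
      rcases h1.lt_or_eq with h1 | h1
      · exact h1
      · rw [hqi h1] at h; omega
  let R : Fin P.n → Fin P.n → Prop := fun x y =>
    (p x ≤ p k ∧ p x < p y) ∨ (p k < p x ∧ p k < p y ∧ q x < q y)
  have hR : τ.Pairwise R := by
    refine List.pairwise_append.2 ⟨?_, ?_, ?_⟩
    · refine List.Pairwise.imp_of_mem ?_ ((pairwise_idxOf hπ).sublist (List.take_sublist _ _))
      intro x y hx hy h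
      have := hpt.1 hx
      exact .inl ⟨by simp only [hp]; simp only [hp] at this; omega, h⟩
    · refine List.Pairwise.imp_of_mem ?_ ((pairwise_idxOf hσ).sublist
        (List.filter_sublist.trans (List.drop_sublist (q k + 1) _)))
      intro x y hx hy h
      simp only [List.mem_filter, decide_eq_true_eq] at hx hy
      exact .inr ⟨hx.2, hy.2, h⟩
    · intro x hx y hy
      simp only [List.mem_filter, decide_eq_true_eq] at hy
      have hx := hpt.1 hx
      have h2 := hy.2
      simp only [hp] at hx h2
      exact .inl ⟨by simp only [hp]; omega, by simp only [hp]; omega⟩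
  have hτn : τ.Nodup := hR.imp fun {x y} h => by
    rintro rfl; simp only [R] at h; omega
  refine ⟨τ, hτn, hτm, ?_⟩
  intro τ₁ i τ₂ e
  have key : ∃ j, (∀ x ∈ τ₁ ++ [i], p x ≤ p j) ∧ (∀ x ∈ i :: τ₂, q j ≤ q x) := by
    rw [e, List.pairwise_append, List.pairwise_cons] at hR
    obtain ⟨-, ⟨hR2, -⟩, hR1⟩ := hR
    have hR1 : ∀ x ∈ τ₁, R x i := fun x hx => hR1 x hx i (by simp)
    -- If `i` lies in the π-part, all later jobs of `τ` also come after `i` in π. Among the jobs not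
    -- before `i` in π, take as `j` the earliest in σ.
    by_cases hi : p i ≤ p k
    · obtain ⟨j, hj, hjm⟩ := Finset.exists_min_image (Finset.univ.filter fun x => p i ≤ p x) q
        ⟨i, by simp⟩
      simp only [Finset.mem_filter, Finset.mem_univ, true_and] at hj hjm
      refine ⟨j, fun x hx => ?_, fun x hx => ?_⟩
      · rcases List.mem_append.1 hx with hx | hx
        · have := hR1 x hx; simp only [R] at this; omega
        · rw [List.mem_singleton] at hx; rw [hx]; exact hj
      · rcases List.mem_cons.1 hx with rfl | hx
        · exact hjm _ le_rfl
        · have := hR2 x hx; simp only [R] at this; exact hjm x (by omega)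
    -- If `i` lies in the σ-part, dually take, among the jobs of that part not after `i` in σ, the
    -- latest one in π.
    · obtain ⟨j, hj, hjm⟩ := Finset.exists_max_image
        (Finset.univ.filter fun x => p k < p x ∧ q x ≤ q i) p ⟨i, by simp; omega⟩
      simp only [Finset.mem_filter, Finset.mem_univ, true_and] at hj hjm
      have hji := hjm i ⟨by omega, le_rfl⟩
      refine ⟨j, fun x hx => ?_, fun x hx => ?_⟩
      · rcases List.mem_append.1 hx with hx | hx
        · have := hR1 x hx
          simp only [R] at this
          by_cases hx : p x ≤ p k
          · omega
          · exact hjm x (by omega)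
        · rw [List.mem_singleton] at hx; rw [hx]; exact hji
      · rcases List.mem_cons.1 hx with rfl | hx
        · exact hj.2
        · have := hR2 x hx; simp only [R] at this; omega
  obtain ⟨j, h1, h2⟩ := key
  refine ⟨j, fun x hx => hpt.2 (Nat.lt_succ_of_le (h1 x hx)), fun x hx => hqd.2 (h2 x hx), ?_⟩
  -- `τ` is a subsequence of the walk belonging to `k`, and the tour of `k` is minimal among
  -- covering jobs; `j` is covering because the split of `τ` contains every job.
  refine le_trans ?_ (hk j ?_)
  · exact P.tour_le_of_sublist (List.filter_sublist.append_left _) _ _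
  · simp only [E, Finset.mem_filter, Finset.mem_univ, true_and]
    intro x
    have hx := hτm x
    rw [e] at hx
    rcases List.mem_append.1 hx with hx | hx
    · exact .inl (h1 x (by simp [hx]))
    · exact .inr (h2 x hx)

theorem le_makespan {P : Problem g} (S : Schedule P) (j : Fin P.n) :
    S.startB j + P.b j + P.dist (.job (P.loc j)) .finish ≤ S.makespan :=
  le_ciSup (f := fun j => S.startB j + P.b j + P.dist (.job (P.loc j)) .finish)
    (Set.finite_range _).bddAbove j

/-- For each critical job of `τ`, the dominating `j` gives a chain in the given schedule: A works
through its prefix up to `j`, then B through its suffix from `j`, and the two walks join at the node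
of `j`. -/
theorem exists_cost_le_makespan {P : Problem g} (hn : 0 < P.n) {S : Schedule P} (hS : S.Feasible) :
    ∃ τ : List (Fin P.n), τ.Nodup ∧ (∀ j, j ∈ τ) ∧ P.cost τ ≤ S.makespan := by
  classical
  obtain ⟨hA, hB, hAB⟩ := hS
  obtain ⟨π, hπ, hπm, hπb⟩ := hA.exists_order P.a_nonneg
  obtain ⟨σ, hσ, hσm, hσb⟩ := hB.exists_order P.b_nonneg
  obtain ⟨τ, hτ, hτm, h⟩ := P.exists_common_order hn hπ hσ hπm hσm
  refine ⟨τ, hτ, hτm, ?_⟩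
  rw [cost, ← le_sub_iff_add_le]
  refine P.flow_le (List.ne_nil_of_mem (hτm ⟨0, hn⟩)) fun τ₁ i τ₂ e => ?_
  obtain ⟨j, h1, h2, h3⟩ := h τ₁ i τ₂ e
  rw [e, List.nodup_append] at hτ
  have hn1 : (τ₁ ++ [i]).Nodup := by
    rw [List.nodup_append]
    exact ⟨hτ.1, by simp, fun a ha b hb => hτ.2.2 a ha b (by simp at hb; simp [hb])⟩
  have h4 := P.asum_le_of_subset hn1 h1
  have h5 := P.bsum_le_of_subset hτ.2.1 h2
  rw [take_idxOf_succ (hπm j)] at h3 h4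
  rw [drop_idxOf (hσm j)] at h5
  rw [List.append_assoc, List.singleton_append, tour_append_cons] at h3
  have h6 := P.add_tour_le_start (c := 0) (u := .start) (L := π.take (π.idxOf j)) (j := j)
    (p := P.a) (s := S.startA) (fun k _ => by simpa [node] using hA.1 k)
    (by rw [← take_idxOf_succ (hπm j)]; exact hπb.sublist (List.take_sublist _ _))
  have h7 := P.start_add_tour_le (w := .finish) (L := σ.drop (σ.idxOf j + 1)) (j := j)
    (p := P.b) (s := S.startB) (le_makespan S)
    (by rw [← drop_idxOf (hσm j)]; exact hσb.sublist (List.drop_sublist _ _))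
  have h8 := hAB j
  simp only [asum_append, asum_cons, asum_nil, bsum_cons] at h4 h5 ⊢
  simp only [asum, bsum] at *
  linarith

end Problem
end RoutingFlowShop

namespace RoutingFlowShop

variable {g : ℕ}

/-! ### Rules for programs -/

section Timed

variable {α β σ : Type}

@[simp] theorem bind_val (x : Timed α) (f : α → Timed β) : (x >>= f).val = (f x.val).val := rfl
@[simp] theorem bind_steps (x : Timed α) (f : α → Timed β) :
    (x >>= f).steps = x.steps + (f x.val).steps := rfl
@[simp] theorem pure_val (x : α) : (pure x : Timed α).val = x := rfl
@[simp] theorem pure_steps (x : α) : (pure x : Timed α).steps = 0 := rfl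
@[simp] theorem charge_val (c : ℕ) (x : α) : (charge c x).val = x := rfl
@[simp] theorem charge_steps (c : ℕ) (x : α) : (charge c x).steps = c := rfl
@[simp] theorem op_val (x : α) : (op x).val = x := rfl
@[simp] theorem op_steps (x : α) : (op x).steps = 1 := rfl
@[simp] theorem tick_steps : tick.steps = 1 := rfl

theorem forEach_nil (body : α → σ → Timed σ) (s : σ) :
    (forEach body [] s).val = s ∧ (forEach body [] s).steps = 1 := ⟨rfl, rfl⟩

theorem forEach_cons_val (body : α → σ → Timed σ) (x : α) (l : List α) (s : σ) :
    (forEach body (x :: l) s).val = (forEach body l (body x s).val).val := rfl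

theorem forEach_cons_steps (body : α → σ → Timed σ) (x : α) (l : List α) (s : σ) :
    (forEach body (x :: l) s).steps =
      1 + ((body x s).steps + (forEach body l (body x s).val).steps) := rfl

/-- `I` is an invariant, and `Φ x` is a lasting effect of the iteration for `x`. -/
theorem forEach_spec {body : α → σ → Timed σ} (I : σ → Prop) (Φ : α → σ → Prop) (c : α → ℕ)
    {l : List α} {s : σ} (hI : I s)
    (h : ∀ x ∈ l, ∀ s, I s → I (body x s).val ∧ Φ x (body x s).val ∧
      (∀ y, Φ y s → Φ y (body x s).val) ∧ (body x s).steps ≤ c x) :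
    I (forEach body l s).val ∧ (∀ x ∈ l, Φ x (forEach body l s).val) ∧
      (∀ y, Φ y s → Φ y (forEach body l s).val) ∧
      (forEach body l s).steps ≤ (l.map fun x => c x + 1).sum + 1 := by
  induction l generalizing s with
  | nil => exact ⟨hI, by simp, fun y hy => hy, le_rfl⟩
  | cons x l ih =>
    obtain ⟨h1, h2, h3, h4⟩ := h x (by simp) s hI
    obtain ⟨k1, k2, k3, k4⟩ := ih h1 fun y hy => h y (by simp [hy])
    rw [forEach_cons_val, forEach_cons_steps]
    refine ⟨k1, ?_, fun y hy => k3 y (h3 y hy), ?_⟩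
    · intro y hy
      rcases List.mem_cons.1 hy with rfl | hy
      · exact k3 _ h2
      · exact k2 y hy
    · simp only [List.map_cons, List.sum_cons]; omega

/-- An invariant that depends on the list of the remaining elements. -/
theorem forEach_rest {body : α → σ → Timed σ} (I : List α → σ → Prop) (c : ℕ)
    (h : ∀ x l s, I (x :: l) s → I l (body x s).val ∧ (body x s).steps ≤ c)
    {l : List α} {s : σ} (hI : I l s) :
    I [] (forEach body l s).val ∧ (forEach body l s).steps ≤ (c + 1) * l.length + 1 := by
  induction l generalizing s with
  | nil => exact ⟨hI, by simp [forEach_nil]⟩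
  | cons x l ih =>
    obtain ⟨h1, h2⟩ := h x l s hI
    obtain ⟨k1, k2⟩ := ih h1
    rw [forEach_cons_val, forEach_cons_steps]
    refine ⟨k1, ?_⟩
    rw [List.length_cons, mul_add, mul_one]
    omega

theorem rewind_spec (l m : List α) :
    (rewind l m).val = l.reverse ++ m ∧ (rewind l m).steps = 2 * l.length + 1 := by
  induction l generalizing m with
  | nil => exact ⟨rfl, rfl⟩
  | cons x l ih =>
    have := ih (x :: m)
    simp only [rewind, bind_val, bind_steps, op_val, op_steps, tick_steps, this, List.length_cons]
    exact ⟨by simp, by omega⟩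

theorem takeRev_spec (k : ℕ) (l m : List α) :
    (takeRev k l m).val = (l.take k).reverse ++ m ∧ (takeRev k l m).steps ≤ 2 * l.length + 1 := by
  induction l generalizing m k with
  | nil => cases k <;> simp [takeRev]
  | cons x l ih =>
    cases k with
    | zero => simp [takeRev]
    | succ k =>
      have := ih k (x :: m)
      simp only [takeRev, bind_val, bind_steps, op_val, op_steps, tick_steps, this,
        List.length_cons]
      exact ⟨by simp, by omega⟩

end Timed

/-! ### Numbering the jobs -/

namespace Problem

variable (P : Problem g)

/-- The lists of the jobs of all nodes in the order given by Johnson's rule. -/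
def IsNumbering (J : Fin g → List (Fin P.n)) : Prop :=
  ∀ i, (J i).Pairwise P.Prec ∧ ∀ j, j ∈ J i ↔ P.loc j = i

theorem nodup_of_pairwise_prec {L : List (Fin P.n)} (h : L.Pairwise P.Prec) : L.Nodup :=
  h.imp fun {x y} h => by rintro rfl; exact P.not_prec_self _ h

theorem length_le_of_nodup {L : List (Fin P.n)} (h : L.Nodup) : L.length ≤ P.n := by
  simpa using h.length_le_card

end Problem

theorem insertJob_spec (P : Problem g) (j : Fin P.n) (l : List (Fin P.n)) :
    (insertJob P j l).val.Perm (j :: l) ∧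
    (l.Pairwise P.Prec → j ∉ l → (insertJob P j l).val.Pairwise P.Prec) ∧
    (insertJob P j l).steps ≤ 15 * (l.length + 1) := by
  induction l with
  | nil => simp [insertJob]
  | cons k l ih =>
    obtain ⟨h1, h2, h3⟩ := ih
    by_cases h : P.Prec j k
    · simp only [insertJob, bind_val, bind_steps, charge_val, charge_steps, tick_steps, op_val,
        op_steps, h, decide_true, if_true, List.length_cons]
      refine ⟨.refl _, fun hl _ => ?_, by omega⟩
      refine List.pairwise_cons.2 ⟨fun x hx => ?_, hl⟩
      rcases List.mem_cons.1 hx with rfl | hx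
      · exact h
      · exact h.trans ((List.pairwise_cons.1 hl).1 x hx)
    · simp only [insertJob, bind_val, bind_steps, charge_val, charge_steps, tick_steps, op_val,
        op_steps, h, decide_false, Bool.false_eq_true, if_false, List.length_cons]
      refine ⟨(h1.cons k).trans (.swap _ _ _), fun hl hj => ?_, by omega⟩
      rw [List.pairwise_cons] at hl
      simp only [List.mem_cons, not_or] at hj
      refine List.pairwise_cons.2 ⟨fun x hx => ?_, h2 hl.2 hj.2⟩
      rcases List.mem_cons.1 (h1.subset hx) with rfl | hx
      · exact (P.prec_trichotomy hj.1).resolve_left h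
      · exact hl.1 x hx

theorem sortJobs_spec (P : Problem g) :
    P.IsNumbering (sortJobs P).val ∧
      (sortJobs P).steps ≤ g + ((15 * (P.n + 1) + 4) * P.n + 1) := by
  have := forEach_rest (α := Fin P.n) (σ := Fin g → List (Fin P.n)) (body := fun j J => do
      let i ← op (P.loc j)
      let l ← op (J i)
      let l ← insertJob P j l
      op (Function.update J i l))
    -- Here `r` is the list of jobs still to be inserted, so each list holds exactly the other jobs
    -- of its node.
    (fun r J => r.Nodup ∧ ∀ i, (J i).Pairwise P.Prec ∧ ∀ j, j ∈ J i ↔ P.loc j = i ∧ j ∉ r)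
    (15 * (P.n + 1) + 3) (fun j r J ⟨hr, hJ⟩ => by
      obtain ⟨h1, h2, h3⟩ := insertJob_spec P j (J (P.loc j))
      have h4 : j ∉ J (P.loc j) := fun h => ((hJ _).2 j |>.1 h).2 (by simp)
      have h5 := P.length_le_of_nodup (P.nodup_of_pairwise_prec (hJ (P.loc j)).1)
      rw [List.nodup_cons] at hr
      simp only [bind_val, bind_steps, op_val, op_steps]
      refine ⟨⟨hr.2, fun i => ?_⟩, by omega⟩
      by_cases hi : i = P.loc j
      · subst hi
        simp only [Function.update_self]
        refine ⟨h2 (hJ _).1 h4, fun k => ?_⟩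
        rw [h1.mem_iff, List.mem_cons, (hJ _).2 k, List.mem_cons]
        constructor
        · rintro (rfl | h)
          · exact ⟨rfl, hr.1⟩
          · tauto
        · tauto
      · simp only [Function.update_of_ne hi]
        refine ⟨(hJ i).1, fun k => ?_⟩
        rw [(hJ _).2 k, List.mem_cons]
        constructor
        · tauto
        · rintro ⟨rfl, h⟩
          exact ⟨rfl, by rintro (rfl | h'); exacts [hi rfl, h h']⟩)
    (l := List.finRange P.n) (s := fun _ => []) ⟨List.nodup_finRange _, by simp⟩
  rw [List.length_finRange] at this
  refine ⟨fun i => ⟨(this.1.2 i).1, fun j => ?_⟩, ?_⟩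
  · exact ((this.1.2 i).2 j).trans (by simp)
  · exact Nat.add_le_add_left this.2 g

theorem countJobs_spec (P : Problem g) {J : Fin g → List (Fin P.n)} (hJ : P.IsNumbering J) :
    (∀ i, (countJobs P).val i = (J i).length) ∧ (countJobs P).steps ≤ g + (5 * P.n + 1) := by
  have := forEach_rest (α := Fin P.n) (σ := Fin g → ℕ) (body := fun j N => do
      let i ← op (P.loc j)
      let c ← op (N i)
      let c ← op (c + 1)
      op (Function.update N i c))
    (fun r N => ∀ i, N i + r.countP (P.loc · = i) = (J i).length) 4
    (fun j r N h => ⟨fun i => by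
      have := h i
      rw [List.countP_cons] at this
      simp only [bind_val, op_val]
      by_cases hi : P.loc j = i
      · subst hi; simp at this ⊢; omega
      · rw [Function.update_of_ne (Ne.symm hi)]; simpa [hi] using this, by simp⟩)
    (l := List.finRange P.n) (s := fun _ => 0) (fun i => by
      rw [zero_add, List.countP_eq_length_filter]
      refine List.Perm.length_eq ((List.perm_ext_iff_of_nodup ?_ ?_).2 ?_)
      · exact (List.nodup_finRange _).filter _
      · exact P.nodup_of_pairwise_prec (hJ i).1
      · intro j; simp [(hJ i).2])
  rw [List.length_finRange] at this
  exact ⟨fun i => this.1 i, Nat.add_le_add_left this.2 g⟩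

end RoutingFlowShop

namespace RoutingFlowShop

variable {g : ℕ}

/-! ### Lists of solutions -/

/-- The solutions are pairwise incomparable and sorted by ascending `f1`. -/
def Pareto (F : List (Sol g)) : Prop := F.Pairwise fun s t => s.f1 < t.f1 ∧ t.f2 < s.f2

/-- Some solution of the list majorizes the pair `(x, y)`. -/
def Majorizes (F : List (Sol g)) (x : ℝ) (y : WithTop ℝ) : Prop := ∃ s ∈ F, s.f1 ≤ x ∧ s.f2 ≤ y

theorem Majorizes.mono {F : List (Sol g)} {x x' : ℝ} {y y' : WithTop ℝ} (h : Majorizes F x y)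
    (hx : x ≤ x') (hy : y ≤ y') : Majorizes F x' y' :=
  let ⟨s, hs, h1, h2⟩ := h
  ⟨s, hs, h1.trans hx, h2.trans hy⟩

/-- The whole list. -/
def Zipper.toList (z : Zipper g) : List (Sol g) := z.left.reverse ++ z.ctrl :: z.right

/-- The number of elements to the right of the pointer, with weight 3, is a potential that pays for
the moves. This makes a whole scan linear, although a single call may be long. -/
theorem advance_spec (x : ℝ) (L : List (Sol g)) (c : Sol g) (R : List (Sol g)) (hc : c.f1 ≤ x)
    (hP : Pareto (c :: R)) :
    (advance x L c R).val.toList = L.reverse ++ c :: R ∧ (advance x L c R).val.ctrl.f1 ≤ x ∧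
      (∀ t ∈ (advance x L c R).val.right, x < t.f1) ∧
      (advance x L c R).steps + 3 * (advance x L c R).val.right.length ≤ 3 * R.length + 2 := by
  induction R generalizing L c with
  | nil => simp [advance, Zipper.toList, hc]
  | cons s R ih =>
    have hP' : Pareto (s :: R) := (List.pairwise_cons.1 hP).2
    by_cases h : s.f1 ≤ x
    · obtain ⟨h1, h2, h3, h4⟩ := ih (c :: L) s h hP'
      simp only [advance, bind_val, bind_steps, op_val, op_steps, tick_steps, h, decide_true,
        if_true, List.length_cons]
      refine ⟨by simpa using h1, h2, h3, by omega⟩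
    · simp only [advance, bind_val, bind_steps, op_val, op_steps, tick_steps, h, decide_false,
        Bool.false_eq_true, if_false, pure_val, pure_steps, List.length_cons]
      refine ⟨by simp [Zipper.toList], hc, ?_, by omega⟩
      intro t ht
      rcases List.mem_cons.1 ht with rfl | ht
      · exact not_le.1 h
      · exact (not_le.1 h).trans ((List.pairwise_cons.1 hP').1 t ht).1

/-- Since `f2` decreases along the list, the elements to be removed form an initial segment. -/
theorem dropMajorized_spec (y : WithTop ℝ) (R : List (Sol g)) (hP : Pareto R) :
    (dropMajorized y R).val.Sublist R ∧ (∀ t ∈ (dropMajorized y R).val, t.f2 < y) ∧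
      (∀ t ∈ R, t ∈ (dropMajorized y R).val ∨ y ≤ t.f2) ∧
      (dropMajorized y R).steps + 2 * (dropMajorized y R).val.length ≤ 2 * R.length + 2 := by
  induction R with
  | nil => simp [dropMajorized]
  | cons s R ih =>
    have hP' := List.pairwise_cons.1 hP
    by_cases h : y ≤ s.f2
    · obtain ⟨h1, h2, h3, h4⟩ := ih hP'.2
      simp only [dropMajorized, bind_val, bind_steps, op_val, op_steps, tick_steps, h, decide_true,
        if_true, List.length_cons]
      refine ⟨h1.cons s, h2, fun t ht => ?_, by omega⟩
      rcases List.mem_cons.1 ht with rfl | ht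
      · exact .inr h
      · exact h3 t ht
    · simp only [dropMajorized, bind_val, bind_steps, op_val, op_steps, tick_steps, h, decide_false,
        Bool.false_eq_true, if_false, pure_val, pure_steps, List.length_cons]
      refine ⟨.refl _, fun t ht => ?_, fun t ht => .inl ht, by omega⟩
      rcases List.mem_cons.1 ht with rfl | ht
      · exact not_le.1 h
      · exact (hP'.1 t ht).2.trans (not_le.1 h)

theorem pareto_insert {L R R' : List (Sol g)} {s : Sol g} (hP : Pareto (L ++ R))
    (hR : R'.Sublist R) (hL1 : ∀ t ∈ L, t.f1 < s.f1) (hL2 : ∀ t ∈ L, s.f2 < t.f2)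
    (hR1 : ∀ t ∈ R, s.f1 < t.f1) (hR2 : ∀ t ∈ R', t.f2 < s.f2) : Pareto (L ++ s :: R') := by
  have h := List.pairwise_append.1 hP
  refine List.pairwise_append.2 ⟨h.1, List.pairwise_cons.2 ⟨fun t ht => ?_, h.2.1.sublist hR⟩,
    fun t ht u hu => ?_⟩
  · exact ⟨hR1 t (hR.subset ht), hR2 t ht⟩
  · rcases List.mem_cons.1 hu with rfl | hu
    · exact ⟨hL1 t ht, hL2 t ht⟩
    · exact h.2.2 t ht u (hR.subset hu)

/-- Elements left of the control element have larger `f2` than it, and those to the right have `f1`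
beyond the applicant, so the control element alone decides whether the applicant is majorized. An
applicant with `f2 = ⊤` is always rejected, so no infinite pair enters the list. The step bound is
amortized as in `advance_spec`. -/
theorem offer_spec (s : Sol g) (z : Zipper g) (hP : Pareto z.toList) (hz : z.ctrl.f1 ≤ s.f1) :
    Pareto (offer s z).val.toList ∧ (offer s z).val.ctrl.f1 ≤ s.f1 ∧
      Majorizes (offer s z).val.toList s.f1 s.f2 ∧
      (∀ x y, Majorizes z.toList x y → Majorizes (offer s z).val.toList x y) ∧
      (∀ t ∈ (offer s z).val.toList, t ∈ z.toList ∨ (t = s ∧ s.f2 ≠ ⊤)) ∧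
      (offer s z).val.toList.length ≤ z.toList.length + 1 ∧
      (offer s z).steps + 3 * (offer s z).val.right.length ≤ 3 * z.right.length + 7 := by
  obtain ⟨h1, h2, h3, h4⟩ := advance_spec s.f1 z.left z.ctrl z.right hz
    (List.pairwise_append.1 hP).2.1
  change _ = z.toList at h1
  rw [← h1] at hP ⊢
  clear h1
  simp only [offer, bind_val, bind_steps, op_val, op_steps]
  set w := (advance s.f1 z.left z.ctrl z.right).val
  have hP' := List.pairwise_append.1 hP
  have hP2 := List.pairwise_cons.1 hP'.2.1
  by_cases hc : w.ctrl.f2 ≤ s.f2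
  · simp only [hc, decide_true, if_true, pure_val, pure_steps]
    exact ⟨hP, h2, ⟨w.ctrl, by simp [Zipper.toList], h2, hc⟩, fun _ _ h => h, fun t ht => .inl ht,
      by omega, by omega⟩
  obtain ⟨d1, d2, d3, d4⟩ := dropMajorized_spec s.f2 w.right hP2.2
  have d5 := d1.length_le
  have hs : s.f2 < w.ctrl.f2 := not_le.1 hc
  have hl1 : ∀ t ∈ w.left.reverse, t.f1 < s.f1 := fun t ht =>
    (hP'.2.2 t ht w.ctrl (by simp)).1.trans_le h2
  have hl2 : ∀ t ∈ w.left.reverse, s.f2 < t.f2 := fun t ht =>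
    hs.trans (hP'.2.2 t ht w.ctrl (by simp)).2
  by_cases he : w.ctrl.f1 = s.f1
  · simp only [hc, he, decide_false, Bool.false_eq_true, if_false, decide_true, if_true, bind_val,
      bind_steps, op_val, op_steps, pure_val, pure_steps, Zipper.toList]
    refine ⟨?_, le_rfl, ⟨s, by simp, le_rfl, le_rfl⟩, ?_, ?_, ?_, by omega⟩
    · exact pareto_insert (hP.sublist (by simp [Zipper.toList])) d1 hl1 hl2 h3 d2
    · rintro x y ⟨t, ht, hx, hy⟩
      simp only [List.mem_append, List.mem_cons] at ht
      rcases ht with ht | rfl | ht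
      · exact ⟨t, by simp at ht; simp [ht], hx, hy⟩
      · exact ⟨s, by simp, he ▸ hx, hs.le.trans hy⟩
      · rcases d3 t ht with h | h
        · exact ⟨t, by simp [h], hx, hy⟩
        · exact ⟨s, by simp, (h3 t ht).le.trans hx, h.trans hy⟩
    · intro t ht
      simp only [List.mem_append, List.mem_cons] at ht ⊢
      rcases ht with ht | rfl | ht
      · tauto
      · exact .inr ⟨rfl, hs.ne_top⟩
      · have := d1.subset ht; tauto
    · simp only [List.length_append, List.length_cons]; omega
  · simp only [hc, he, decide_false, Bool.false_eq_true, if_false, bind_val,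
      bind_steps, op_val, op_steps, pure_val, pure_steps, Zipper.toList]
    refine ⟨?_, le_rfl, ⟨s, by simp, le_rfl, le_rfl⟩, ?_, ?_, ?_, by omega⟩
    · rw [List.reverse_cons]
      refine pareto_insert (R := w.right) (by simpa [Zipper.toList] using hP) d1 ?_ ?_ h3 d2
      · intro t ht
        rcases List.mem_append.1 ht with ht | ht
        · exact hl1 t ht
        · rw [List.mem_singleton.1 ht]; exact lt_of_le_of_ne h2 he
      · intro t ht
        rcases List.mem_append.1 ht with ht | ht
        · exact hl2 t ht
        · rw [List.mem_singleton.1 ht]; exact hs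
    · rintro x y ⟨t, ht, hx, hy⟩
      simp only [List.mem_append, List.mem_cons] at ht
      rcases ht with ht | rfl | ht
      · exact ⟨t, by simp at ht; simp [ht], hx, hy⟩
      · exact ⟨w.ctrl, by simp, hx, hy⟩
      · rcases d3 t ht with h | h
        · exact ⟨t, by simp [h], hx, hy⟩
        · exact ⟨s, by simp, (h3 t ht).le.trans hx, h.trans hy⟩
    · intro t ht
      simp only [List.reverse_cons, List.mem_append, List.mem_cons, List.not_mem_nil, or_false]
        at ht ⊢
      rcases ht with (ht | rfl) | rfl | ht
      · tauto
      · tauto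
      · exact .inr ⟨rfl, hs.ne_top⟩
      · have := d1.subset ht; tauto
    · simp only [List.length_append, List.length_cons, List.length_reverse]; omega

/-- The solution obtained from `s` with a finite value `w` of `s.f2` by going to node `i` and
performing there `d` jobs with characteristics `B`. -/
noncomputable def Sol.extend (s : Sol g) (w : ℝ) (i : Fin g) (d : ℕ) (r : ℝ) (B : Block) : Sol g :=
  ⟨s.f1 + r + B.l1, ((max (w + r + B.l2) (s.f1 + r + B.c) : ℝ) : WithTop ℝ), (i, d) :: s.route⟩

/-- Both branches compute the same maximum, with the test choosing the larger term. Each solution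
costs at most 8 steps of its own and 7 amortized steps in `offer`. -/
theorem scan_spec (i : Fin g) (d : ℕ) (r : ℝ) (B : Block) (ss : List (Sol g)) (z : Zipper g)
    (hP : Pareto z.toList) (hs : Pareto ss) (hz : ∀ s ∈ ss, z.ctrl.f1 ≤ s.f1 + r + B.l1) :
    Pareto (scan i d r B (B.c - B.l2) ss z).val.toList ∧
      (∀ s ∈ ss, ∀ t : ℝ, s.f2 ≤ t → Majorizes (scan i d r B (B.c - B.l2) ss z).val.toList
        (s.f1 + r + B.l1) ((max (t + r + B.l2) (s.f1 + r + B.c) : ℝ) : WithTop ℝ)) ∧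
      (∀ x y, Majorizes z.toList x y →
        Majorizes (scan i d r B (B.c - B.l2) ss z).val.toList x y) ∧
      (∀ t ∈ (scan i d r B (B.c - B.l2) ss z).val.toList, t ∈ z.toList ∨
        ∃ s ∈ ss, ∃ w : ℝ, s.f2 = w ∧ t = s.extend w i d r B) ∧
      (scan i d r B (B.c - B.l2) ss z).val.toList.length ≤ z.toList.length + ss.length ∧
      (scan i d r B (B.c - B.l2) ss z).steps +
        3 * (scan i d r B (B.c - B.l2) ss z).val.right.length ≤
          3 * z.right.length + 15 * ss.length + 1 := by
  induction ss generalizing z with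
  | nil =>
    simp only [scan, bind_val, bind_steps, tick_steps, pure_val, pure_steps]
    exact ⟨hP, by simp, fun _ _ h => h, fun t ht => .inl ht, by simp, by simp; omega⟩
  | cons s ss ih =>
    have hs' := List.pairwise_cons.1 hs
    by_cases h : ((s.f1 + (B.c - B.l2) : ℝ) : WithTop ℝ) ≤ s.f2
    · simp only [scan, bind_val, bind_steps, op_val, op_steps, tick_steps, h, decide_true, if_true]
      set n : Sol g := ⟨s.f1 + r + B.l1, s.f2 + (r : WithTop ℝ) + (B.l2 : WithTop ℝ),
        (i, d) :: s.route⟩ with hn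
      have hw : ∀ w : ℝ, s.f2 = w → n = s.extend w i d r B := by
        intro w hw
        rw [hw, WithTop.coe_le_coe] at h
        have : s.f1 + r + B.c ≤ w + r + B.l2 := by linarith
        rw [hn, Sol.extend, hw, max_eq_left this]
        norm_cast
      obtain ⟨o1, o2, o3, o4, o5, o6, o7⟩ := offer_spec n z hP (hz s (by simp))
      obtain ⟨k1, k2, k3, k4, k5, k6⟩ := ih (offer n z).val o1 hs'.2
        (fun t ht => o2.trans (by linarith [(hs'.1 t ht).1]))
      refine ⟨k1, ?_, fun x y hxy => k3 x y (o4 x y hxy), ?_, ?_, ?_⟩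
      · intro u hu t hut
        rcases List.mem_cons.1 hu with rfl | hu
        · obtain ⟨w, hw'⟩ := WithTop.ne_top_iff_exists.1 (ne_top_of_le_ne_top WithTop.coe_ne_top hut)
          refine (k3 _ _ o3).mono le_rfl ?_
          rw [hw w hw'.symm, Sol.extend, WithTop.coe_le_coe]
          rw [← hw', WithTop.coe_le_coe] at hut
          gcongr
        · exact k2 u hu t hut
      · intro t ht
        rcases k4 t ht with h' | ⟨u, hu, w, h1, h2⟩
        · rcases o5 t h' with h' | ⟨rfl, hne⟩
          · exact .inl h'
          · have : s.f2 ≠ ⊤ := by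
              intro e; exact hne (by simp [hn, e])
            obtain ⟨w, hw'⟩ := WithTop.ne_top_iff_exists.1 this
            exact .inr ⟨s, by simp, w, hw'.symm, hw w hw'.symm⟩
        · exact .inr ⟨u, by simp [hu], w, h1, h2⟩
      · rw [List.length_cons]; omega
      · rw [List.length_cons]; omega
    · simp only [scan, bind_val, bind_steps, op_val, op_steps, tick_steps, h, decide_false,
        Bool.false_eq_true, if_false]
      rw [not_le] at h
      obtain ⟨w, hw⟩ := WithTop.ne_top_iff_exists.1 h.ne_top
      rw [← hw, WithTop.coe_lt_coe] at h
      have hn : (⟨s.f1 + r + B.l1, ((s.f1 + r + B.c : ℝ) : WithTop ℝ), (i, d) :: s.route⟩ : Sol g)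
          = s.extend w i d r B := by
        rw [Sol.extend, max_eq_right (by linarith)]
      set n : Sol g := ⟨s.f1 + r + B.l1, ((s.f1 + r + B.c : ℝ) : WithTop ℝ), (i, d) :: s.route⟩
      obtain ⟨o1, o2, o3, o4, o5, o6, o7⟩ := offer_spec n z hP (hz s (by simp))
      refine ⟨o1, ?_, o4, ?_, ?_, ?_⟩
      -- Early stopping is harmless: every later `u` has `f1` at least that of `s`, hence both
      -- coordinates of its extension are at least those of the pair just offered.
      · intro u hu t hut
        have hsu : s.f1 ≤ u.f1 := by
          rcases List.mem_cons.1 hu with rfl | hu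
          · exact le_rfl
          · exact (hs'.1 u hu).1.le
        refine o3.mono (by simp only [n]; linarith) ?_
        simp only [n, WithTop.coe_le_coe]
        exact le_max_of_le_right (by linarith)
      · intro t ht
        rcases o5 t ht with h' | ⟨rfl, -⟩
        · exact .inl h'
        · exact .inr ⟨s, by simp, w, hw.symm, hn⟩
      · rw [List.length_cons]; omega
      · rw [List.length_cons]; omega

theorem adjust_spec (i : Fin g) (d : ℕ) (r : ℝ) (B : Block) (E F : List (Sol g))
    (hE : Pareto E) (hF : Pareto F) (h0 : Majorizes F 0 ⊤)
    (hE0 : ∀ s ∈ E, 0 ≤ s.f1 + r + B.l1) :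
    Pareto (adjust i d r B (B.c - B.l2) E F).val ∧
      (∀ (x t : ℝ), Majorizes E x t → Majorizes (adjust i d r B (B.c - B.l2) E F).val
        (x + r + B.l1) ((max (t + r + B.l2) (x + r + B.c) : ℝ) : WithTop ℝ)) ∧
      (∀ x y, Majorizes F x y → Majorizes (adjust i d r B (B.c - B.l2) E F).val x y) ∧
      (∀ t ∈ (adjust i d r B (B.c - B.l2) E F).val, t ∈ F ∨
        ∃ s ∈ E, ∃ w : ℝ, s.f2 = w ∧ t = s.extend w i d r B) ∧
      (adjust i d r B (B.c - B.l2) E F).steps ≤ 17 * E.length + 5 * F.length + 4 := by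
  obtain ⟨m, hm, hm0, -⟩ := h0
  cases F with
  | nil => simp at hm
  | cons c R =>
    -- The first element starts no later than any applicant, so it is a legitimate initial control
    -- element.
    have hc : c.f1 ≤ 0 := by
      rcases List.mem_cons.1 hm with rfl | hm
      · exact hm0
      · exact ((List.pairwise_cons.1 hF).1 m hm).1.le.trans hm0
    obtain ⟨h1, h2, h3, h4, h5, h6⟩ := scan_spec i d r B E ⟨[], c, R⟩ (by simpa [Zipper.toList])
      hE (fun s hs => hc.trans (hE0 s hs))
    simp only [adjust, bind_val, bind_steps, op_val, op_steps, tick_steps]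
    set z := (scan i d r B (B.c - B.l2) E ⟨[], c, R⟩).val
    have hr := rewind_spec z.left (z.ctrl :: z.right)
    rw [hr.1, hr.2]
    refine ⟨h1, ?_, h3, h4, ?_⟩
    · rintro x t ⟨s, hs, hx, ht⟩
      refine (h2 s hs t ht).mono (by linarith) ?_
      rw [WithTop.coe_le_coe]
      gcongr
    · simp only [Zipper.toList, List.length_append, List.length_reverse, List.length_cons,
        List.length_nil] at h5 h6 ⊢
      omega

end RoutingFlowShop

namespace RoutingFlowShop

variable {g : ℕ}

/-! ### Solutions of configurations -/

namespace Problem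

variable (P : Problem g)

theorem trav_endNode_block {i : Fin g} {u : Node g} {L : List (Fin P.n)} (hL : L ≠ [])
    (h : ∀ j ∈ L, P.loc j = i) :
    P.trav u L = P.dist u (.job i) ∧ P.endNode u L = .job i := by
  induction L generalizing u with
  | nil => exact absurd rfl hL
  | cons x L ih =>
    have hx : P.node x = .job i := by simp [node, h x (by simp)]
    rcases eq_or_ne L [] with rfl | hne
    · simp [hx]
    · have := ih (u := .job i) hne fun j hj => h j (by simp [hj])
      simp [hx, this, P.dist_self]

/-- The numbers of the jobs of a sequence at the job nodes. -/
def count (L : List (Fin P.n)) (v : Fin g) : ℕ := (L.filter (P.loc · = v)).length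

/-- The characteristics of a block of jobs at one node. -/
noncomputable def block (L : List (Fin P.n)) : Block := ⟨P.asum L, P.bsum L, P.flow L⟩

/-- The sequence performs exactly the first `K v` jobs of each node `v`, and ends at node `u`. -/
structure Reaches (J : Fin g → List (Fin P.n)) (K : Fin g → ℕ) (u : Node g)
    (L : List (Fin P.n)) : Prop where
  isPrefix : ∀ v, L.filter (P.loc · = v) <+: J v
  count_eq : P.count L = K
  endNode_eq : P.endNode .start L = u

/-- The steps of the process, the last one first, describe the job sequence. -/
inductive Expands : List (Fin g × ℕ) → List (Fin P.n) → Prop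
  | nil : Expands [] []
  | cons {rt : List (Fin g × ℕ)} {L M : List (Fin P.n)} {i : Fin g} (h : Expands rt L)
    (hM : M ≠ []) (hi : ∀ j ∈ M, P.loc j = i) : Expands ((i, M.length) :: rt) (L ++ M)

/-- The completion time on machine `A`. -/
def endA (L : List (Fin P.n)) : ℝ := P.asum L + P.trav .start L

/-- The completion time on machine `B`. -/
noncomputable def endB (L : List (Fin P.n)) : ℝ := P.flow L + P.trav .start L

/-- The solution is the dummy pair or is attained by a job sequence. -/
def Sound (J : Fin g → List (Fin P.n)) (K : Fin g → ℕ) (u : Node g) (s : Sol g) : Prop :=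
  (s.f1 = 0 ∧ s.f2 = ⊤) ∨
    ∃ L, P.Reaches J K u L ∧ s.f1 = P.endA L ∧ s.f2 = (P.endB L : ℝ) ∧ P.Expands s.route L

/-- A correct list of the Pareto-optimal solutions of a configuration. -/
structure Correct (J : Fin g → List (Fin P.n)) (K : Fin g → ℕ) (u : Node g)
    (F : List (Sol g)) : Prop where
  pareto : Pareto F
  sound : ∀ s ∈ F, P.Sound J K u s
  complete : ∀ L, P.Reaches J K u L → Majorizes F (P.endA L) (P.endB L : ℝ)

variable {P} {J : Fin g → List (Fin P.n)} {K : Fin g → ℕ} {u : Node g} {L : List (Fin P.n)}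

theorem endA_nonneg : 0 ≤ P.endA L := add_nonneg (P.asum_nonneg L) (P.trav_nonneg _ L)

theorem Sound.f1_nonneg {s : Sol g} (h : P.Sound J K u s) : 0 ≤ s.f1 := by
  rcases h with h | ⟨L, -, h, -⟩
  · exact h.1.ge
  · rw [h]; exact endA_nonneg

theorem Reaches.filter_eq (h : P.Reaches J K u L) (v : Fin g) :
    L.filter (P.loc · = v) = (J v).take (K v) := by
  rw [(List.prefix_iff_eq_take.1 (h.isPrefix v)), ← h.count_eq]; rfl

theorem Reaches.eq_nil (h : P.Reaches J 0 u L) : L = [] := by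
  rw [List.eq_nil_iff_forall_not_mem]
  intro j hj
  have := congrFun h.count_eq (P.loc j)
  simp only [count, Pi.zero_apply, List.length_eq_zero_iff] at this
  have h' : j ∈ L.filter (P.loc · = P.loc j) := by simp [hj]
  rw [this] at h'
  simp at h'

theorem exists_mem_of_endNode {i : Fin g} {w : Node g} (h : P.endNode w L = .job i)
    (hw : w ≠ .job i) : ∃ j ∈ L, P.loc j = i := by
  induction L generalizing w with
  | nil => exact absurd h hw
  | cons x L ih =>
    by_cases hx : P.loc x = i
    · exact ⟨x, by simp, hx⟩
    · obtain ⟨j, hj, e⟩ := ih (w := P.node x) h (by simpa [node] using hx)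
      exact ⟨j, by simp [hj], e⟩

theorem Reaches.pos {i : Fin g} (h : P.Reaches J K (.job i) L) : 0 < K i := by
  obtain ⟨j, hj, e⟩ := exists_mem_of_endNode h.endNode_eq (by simp)
  rw [← h.count_eq, count]
  exact List.length_pos_of_mem (a := j) (by simp [hj, e])

theorem endNode_ne_finish {w : Node g} (hw : w ≠ .finish) : P.endNode w L ≠ .finish := by
  induction L generalizing w with
  | nil => exact hw
  | cons x L ih => exact ih (by simp [node])

theorem endNode_eq_start (h : P.endNode .start L = .start) : L = [] := by
  rcases eq_or_ne L [] with h' | h'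
  · exact h'
  · obtain ⟨M, x, rfl⟩ := List.eq_nil_or_concat L |>.resolve_left h'
    simp [endNode_append, node] at h

theorem correct_initial : P.Correct J 0 .start [initialSol] where
  pareto := by simp [Pareto]
  sound s hs := by
    rw [List.mem_singleton.1 hs]
    exact .inr ⟨[], ⟨fun v => by simp, by funext v; simp [count], rfl⟩, by simp [endA, initialSol],
      by simp [endB, initialSol], .nil⟩
  complete L hL := by
    rw [hL.eq_nil]
    exact ⟨initialSol, by simp, by simp [endA, initialSol], by simp [endB, initialSol]⟩

theorem filter_block_self {M : List (Fin P.n)} {i : Fin g} (hM : ∀ j ∈ M, P.loc j = i) :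
    M.filter (P.loc · = i) = M := List.filter_eq_self.2 (by simpa using hM)

theorem filter_block_ne {M : List (Fin P.n)} {i v : Fin g} (hM : ∀ j ∈ M, P.loc j = i)
    (hv : v ≠ i) : M.filter (P.loc · = v) = [] :=
  List.filter_eq_nil_iff.2 fun j hj => by simpa [hM j hj] using hv.symm

theorem endA_append_block {M : List (Fin P.n)} {i : Fin g} (h0 : M ≠ [])
    (hM : ∀ j ∈ M, P.loc j = i) :
    P.endA (L ++ M) = P.endA L + P.dist (P.endNode .start L) (.job i) + P.asum M := by
  simp only [endA, asum_append, trav_append, (P.trav_endNode_block h0 hM).1]; ring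

/-- With `endA_append_block`, this is the recurrence computed by `Sol.extend`: the old sequence and
the block interact only through the pair of completion times. -/
theorem endB_append_block {M : List (Fin P.n)} {i : Fin g} (h0 : M ≠ [])
    (hM : ∀ j ∈ M, P.loc j = i) :
    P.endB (L ++ M) = max (P.endB L + P.dist (P.endNode .start L) (.job i) + P.bsum M)
      (P.endA L + P.dist (P.endNode .start L) (.job i) + P.flow M) := by
  simp only [endA, endB, flow_append, trav_append, (P.trav_endNode_block h0 hM).1]
  rw [max_comm, ← max_add_add_right]
  congr 1 <;> ring

/-- Performing the next block of jobs at node `i`. -/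
theorem Reaches.append {M : List (Fin P.n)} {i : Fin g} {k : ℕ} (h : P.Reaches J K u L)
    (h0 : M ≠ []) (hM : ∀ j ∈ M, P.loc j = i) (hk : k ≤ (J i).length)
    (e : (J i).take (K i) ++ M = (J i).take k) :
    P.Reaches J (Function.update K i k) (.job i) (L ++ M) where
  isPrefix v := by
    rw [List.filter_append]
    by_cases hv : v = i
    · subst hv
      rw [filter_block_self hM, h.filter_eq, e]
      exact List.take_prefix _ _
    · rw [filter_block_ne hM hv, List.append_nil]
      exact h.isPrefix v
  count_eq := by
    funext v
    rw [count, List.filter_append]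
    by_cases hv : v = i
    · subst hv
      rw [filter_block_self hM, h.filter_eq, e, Function.update_self, List.length_take,
        min_eq_left hk]
    · rw [filter_block_ne hM hv, List.append_nil, Function.update_of_ne hv, ← h.count_eq, count]
  endNode_eq := by rw [endNode_append, (P.trav_endNode_block h0 hM).2]

/-- Removing the last block. -/
theorem Reaches.of_append {M : List (Fin P.n)} {i : Fin g}
    (h : P.Reaches J K u (L ++ M)) (hM : ∀ j ∈ M, P.loc j = i) {k : ℕ} (hk : k + M.length = K i) :
    P.Reaches J (Function.update K i k) (P.endNode .start L) L where
  isPrefix v := by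
    have := h.isPrefix v
    rw [List.filter_append] at this
    exact (List.prefix_append _ _).trans this
  count_eq := by
    funext v
    have := congrFun h.count_eq v
    rw [count, List.filter_append, List.length_append] at this
    by_cases hv : v = i
    · subst hv
      rw [filter_block_self hM] at this
      rw [Function.update_self, count]
      omega
    · rw [filter_block_ne hM hv] at this
      rw [Function.update_of_ne hv, ← this, count]; rfl
  endNode_eq := rfl

/-- The block is taken maximal, so the preceding node differs from `i`. This justifies ignoring
previous nodes `i' = i` in the algorithm. -/
theorem exists_last_block {i : Fin g} (L : List (Fin P.n)) (h : P.endNode .start L = .job i) :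
    ∃ M B, L = M ++ B ∧ B ≠ [] ∧ (∀ j ∈ B, P.loc j = i) ∧ P.endNode .start M ≠ .job i := by
  induction L using List.reverseRecOn with
  | nil => simp at h
  | append_singleton L x ih =>
    have hx : P.loc x = i := by simpa [endNode_append, node] using h
    by_cases hL : P.endNode .start L = .job i
    · obtain ⟨M, B, rfl, h0, hB, hM⟩ := ih hL
      refine ⟨M, B ++ [x], by simp, by simp, ?_, hM⟩
      intro j hj
      rcases List.mem_append.1 hj with hj | hj
      · exact hB j hj
      · rw [List.mem_singleton.1 hj, hx]
    · exact ⟨L, [x], rfl, by simp, by simpa using hx, hL⟩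

end Problem

variable {P : Problem g} {J : Fin g → List (Fin P.n)}

theorem prependJob_spec (j : Fin P.n) (L : List (Fin P.n)) :
    (prependJob P j (P.block L)).val = P.block (j :: L) ∧
      (prependJob P j (P.block L)).steps = 6 := ⟨by simp [prependJob, Problem.block], rfl⟩

/-- The effect of one pre-configuration on the list of solutions of a configuration. -/
theorem adjust_correct {K : Fin g → ℕ} {u : Node g} {i : Fin g} {k : ℕ} {M : List (Fin P.n)}
    {E F : List (Sol g)} (h0 : M ≠ []) (hM : ∀ j ∈ M, P.loc j = i) (hk : k ≤ (J i).length)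
    (e : (J i).take (K i) ++ M = (J i).take k) (hE : P.Correct J K u E) (hF : Pareto F)
    (hF0 : Majorizes F 0 ⊤) (hFs : ∀ s ∈ F, P.Sound J (Function.update K i k) (.job i) s)
    {R : Timed (List (Sol g))} (hR : R = adjust i M.length (P.dist u (.job i)) (P.block M)
      ((P.block M).c - (P.block M).l2) E F) :
    Pareto R.val ∧ (∀ s ∈ R.val, P.Sound J (Function.update K i k) (.job i) s) ∧
      (∀ x y, Majorizes F x y → Majorizes R.val x y) ∧
      (∀ L, P.Reaches J K u L → Majorizes R.val (P.endA (L ++ M)) (P.endB (L ++ M) : ℝ)) ∧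
      R.steps ≤ 17 * E.length + 5 * F.length + 4 := by
  obtain ⟨h1, h2, h3, h4, h5⟩ := adjust_spec i M.length (P.dist u (.job i)) (P.block M) E F
    hE.pareto hF hF0 fun s hs => by
      have := (hE.sound s hs).f1_nonneg
      have := P.dist_nonneg u (.job i)
      have := P.asum_nonneg M
      simp only [Problem.block]; linarith
  rw [← hR] at h1 h2 h3 h4 h5
  refine ⟨h1, fun t ht => ?_, h3, fun L hL => ?_, h5⟩
  · rcases h4 t ht with ht | ⟨s, hs, w, hw, rfl⟩
    · exact hFs t ht
    · rcases hE.sound s hs with ⟨-, h⟩ | ⟨L, hL, e1, e2, hx⟩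
      · rw [h] at hw; exact absurd hw (by simp)
      · rw [hw, WithTop.coe_inj] at e2
        subst e2
        refine .inr ⟨L ++ M, hL.append h0 hM hk e, ?_, ?_, hx.cons h0 hM⟩
        · simp only [Sol.extend, Problem.endA_append_block h0 hM, e1, hL.endNode_eq, Problem.block]
        · simp only [Sol.extend, Problem.endB_append_block h0 hM, e1, hL.endNode_eq, Problem.block]
  · have := h2 _ _ (hE.complete L hL)
    rw [Problem.endA_append_block h0 hM, Problem.endB_append_block h0 hM, hL.endNode_eq]
    exact this

end RoutingFlowShop

namespace RoutingFlowShop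

variable {g : ℕ} {P : Problem g} {J : Fin g → List (Fin P.n)}

/-! ### The main stage -/

/-- The list of the solutions of a configuration that is being created. -/
structure Partial (P : Problem g) (J : Fin g → List (Fin P.n)) (K : Fin g → ℕ) (u : Node g)
    (F : List (Sol g)) : Prop where
  pareto : Pareto F
  majorizes : Majorizes F 0 ⊤
  sound : ∀ s ∈ F, P.Sound J K u s

/-- The jobs in `js` are still outside the block `b`, and `b` is always a final segment of the first
`K₀ i` jobs of node `i`. The completeness clause concerns the blocks longer than `b`, those that the
remaining iterations still try. Pre-configurations have fewer jobs at `i`, which is what `hT` needs.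
-/
theorem loopD_spec {T : Table g} {i : Fin g} {K₀ : Fin g → ℕ} {m₀ : ℕ} (hJ : P.IsNumbering J)
    (hK : K₀ i ≤ (J i).length)
    (hT : ∀ K i', (∀ v, K v ≤ K₀ v) → K i < K₀ i → 0 < K i' → P.Correct J K (.job i') (T K i'))
    (hm : ∀ K u F, Pareto F → (∀ s ∈ F, P.Sound J K u s) → F.length ≤ m₀) (hm1 : 1 ≤ m₀)
    (js : List (Fin P.n)) : ∀ (b : List (Fin P.n)) (k : ℕ) (F : List (Sol g)),
    js.reverse ++ b = (J i).take (K₀ i) → Partial P J K₀ (.job i) F → k = js.length →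
    ∀ R : Timed (List (Sol g)), R = loopD P T i js (Function.update K₀ i k)
      (∑ v, Function.update K₀ i k v) b.length (P.block b) F →
    Partial P J K₀ (.job i) R.val ∧ (∀ x y, Majorizes F x y → Majorizes R.val x y) ∧
    (∀ L M, P.Reaches J K₀ (.job i) (L ++ M) → (∀ j ∈ M, P.loc j = i) →
      P.endNode .start L ≠ .job i → b.length < M.length →
      Majorizes R.val (P.endA (L ++ M)) (P.endB (L ++ M) : ℝ)) ∧
    R.steps ≤ (g + 1) * (g + 26 * m₀ + 17) * js.length + 1 := by
  induction js with
  | nil =>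
    rintro b k F hb hF hk R rfl
    simp only [loopD, bind_val, bind_steps, tick_steps, pure_val, pure_steps]
    refine ⟨hF, fun _ _ h => h, fun L M hL hM _ hlt => ?_, by simp⟩
    have h1 := hL.filter_eq i
    rw [List.filter_append, Problem.filter_block_self hM, ← hb] at h1
    have := congrArg List.length h1
    simp at this
    omega
  | cons j js ih =>
    rintro b k F hb hF hk R rfl
    have hb' : js.reverse ++ (j :: b) = (J i).take (K₀ i) := by simpa using hb
    have hMi : ∀ x ∈ j :: b, P.loc x = i := fun x hx => ((hJ i).2 x).1 <| by
      have : x ∈ (J i).take (K₀ i) := by rw [← hb']; exact List.mem_append_right _ hx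
      exact List.mem_of_mem_take this
    have hlen : js.length + (b.length + 1) = K₀ i := by
      have := congrArg List.length hb'
      simpa [hK] using this
    set K := Function.update K₀ i js.length with hKdef
    have hKi : K i = js.length := Function.update_self ..
    have hK₀ : Function.update K i (K₀ i) = K₀ := by simp [hKdef]
    have htake : (J i).take (K i) ++ (j :: b) = (J i).take (K₀ i) := by
      rw [← hb', hKi]
      congr 1
      have := congrArg (List.take js.length) hb'
      rw [List.take_left' (by simp), List.take_take, min_eq_left (by omega)] at this
      exact this.symm
    have hsum : (∑ v, Function.update K₀ i k v) - 1 = ∑ v, K v := by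
      have h1 := Finset.add_sum_erase Finset.univ (Function.update K₀ i k) (Finset.mem_univ i)
      have h2 := Finset.add_sum_erase Finset.univ K (Finset.mem_univ i)
      have h3 : ∑ v ∈ Finset.univ.erase i, Function.update K₀ i k v =
          ∑ v ∈ Finset.univ.erase i, K v := Finset.sum_congr rfl fun v hv => by
        simp [hKdef, Function.update_of_ne (Finset.ne_of_mem_erase hv)]
      rw [h3] at h1
      rw [Function.update_self] at h1
      rw [hk, List.length_cons] at *
      omega
    have hEq : Function.update (Function.update K₀ i k) i (k - 1) = K := by
      rw [Function.update_idem, hk, List.length_cons, Nat.add_sub_cancel]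
    have hpre := prependJob_spec j b
    have hadj : ∀ {u : Node g} {E F : List (Sol g)}, P.Correct J K u E →
        Partial P J K₀ (.job i) F → ∀ {R}, R = adjust i (b.length + 1) (P.dist u (.job i))
          (P.block (j :: b)) ((P.block (j :: b)).c - (P.block (j :: b)).l2) E F →
        Partial P J K₀ (.job i) R.val ∧ (∀ x y, Majorizes F x y → Majorizes R.val x y) ∧
        (∀ L, P.Reaches J K u L →
          Majorizes R.val (P.endA (L ++ j :: b)) (P.endB (L ++ j :: b) : ℝ)) ∧
        R.steps ≤ 22 * m₀ + 4 := by
      intro u E F hE hF R hR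
      obtain ⟨h1, h2, h3, h4, h5⟩ := adjust_correct (List.cons_ne_nil j b) hMi hK htake hE
        hF.pareto hF.majorizes (by rw [hK₀]; exact hF.sound) hR
      rw [hK₀] at h2
      have := hm _ _ _ hE.pareto hE.sound
      have := hm _ _ _ hF.pareto hF.sound
      exact ⟨⟨h1, h3 _ _ hF.majorizes, h2⟩, h3, h4, by omega⟩
    -- the first part of the iteration
    obtain ⟨F₁, hF₁, hP₁, hM₁, hC₁, hS₁⟩ : ∃ F₁ : Timed (List (Sol g)),
        F₁ = (if (∑ v, K v) = 0 then do
          let r ← op (P.dist .start (.job i))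
          let Fpre ← op [initialSol]
          adjust i (b.length + 1) r (P.block (j :: b))
            ((P.block (j :: b)).c - (P.block (j :: b)).l2) Fpre F
        else pure F) ∧ Partial P J K₀ (.job i) F₁.val ∧
        (∀ x y, Majorizes F x y → Majorizes F₁.val x y) ∧
        (∀ L, P.Reaches J K .start L →
          Majorizes F₁.val (P.endA (L ++ j :: b)) (P.endB (L ++ j :: b) : ℝ)) ∧
        F₁.steps ≤ 22 * m₀ + 6 := by
      refine ⟨_, rfl, ?_⟩
      by_cases h0 : (∑ v, K v) = 0
      · have hK0 : K = 0 := by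
          funext v; exact (Finset.sum_eq_zero_iff.1 h0) v (Finset.mem_univ v)
        obtain ⟨h1, h2, h3, h4⟩ := hadj (u := .start) (E := [initialSol])
          (by rw [hK0]; exact Problem.correct_initial) hF rfl
        rw [if_pos h0]
        exact ⟨h1, h2, h3, by simp only [bind_steps, op_steps, op_val]; omega⟩
      · rw [if_neg h0]
        -- Only the empty sequence ends at the start-depot, so with a nonzero norm there is nothing
        -- to cover here.
        refine ⟨hF, fun _ _ h => h, fun L hL => ?_, by simp⟩
        have h1 := Problem.endNode_eq_start hL.endNode_eq
        have h2 := hL.count_eq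
        rw [h1] at h2
        exact absurd (by rw [← h2]; simp [Problem.count]) h0
    -- the loop on the previous node
    obtain ⟨F₂, hF₂, hP₂, hM₂, hC₂, hS₂⟩ : ∃ F₂ : Timed (List (Sol g)),
        F₂ = forEach (fun i' F => do
          let k' ← op (K i')
          if (← op (decide (i' ≠ i))) && (← op (decide (0 < k'))) then
            let Fpre ← charge (g + 1) (T K i')
            let r ← op (P.dist (.job i') (.job i))
            adjust i (b.length + 1) r (P.block (j :: b))
              ((P.block (j :: b)).c - (P.block (j :: b)).l2) Fpre F
          else
            return F) (List.finRange g) F₁.val ∧ Partial P J K₀ (.job i) F₂.val ∧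
        (∀ x y, Majorizes F₁.val x y → Majorizes F₂.val x y) ∧
        (∀ i', i' ≠ i → ∀ L, P.Reaches J K (.job i') L →
          Majorizes F₂.val (P.endA (L ++ j :: b)) (P.endB (L ++ j :: b) : ℝ)) ∧
        F₂.steps ≤ (22 * m₀ + g + 10) * g + 1 := by
      refine ⟨_, rfl, ?_⟩
      obtain ⟨h1, h2, -, h4⟩ := forEach_spec (l := List.finRange g) (s := F₁.val)
        (fun F => Partial P J K₀ (.job i) F ∧ ∀ x y, Majorizes F₁.val x y → Majorizes F x y)
        (fun i' F => i' ≠ i → ∀ L, P.Reaches J K (.job i') L →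
          Majorizes F (P.endA (L ++ j :: b)) (P.endB (L ++ j :: b) : ℝ))
        (fun _ => 22 * m₀ + g + 9) (body := fun i' F => do
          let k' ← op (K i')
          if (← op (decide (i' ≠ i))) && (← op (decide (0 < k'))) then
            let Fpre ← charge (g + 1) (T K i')
            let r ← op (P.dist (.job i') (.job i))
            adjust i (b.length + 1) r (P.block (j :: b))
              ((P.block (j :: b)).c - (P.block (j :: b)).l2) Fpre F
          else
            return F)
        ⟨hP₁, fun _ _ h => h⟩ (fun i' _ F ⟨hF, hFm⟩ => by
          by_cases hc : i' ≠ i ∧ 0 < K i'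
          · obtain ⟨a1, a2, a3, a4⟩ := hadj (u := .job i') (hT K i' (fun v => by
              by_cases hv : v = i
              · rw [hv, hKi]; omega
              · rw [hKdef, Function.update_of_ne hv]) (by rw [hKi]; omega) hc.2) hF rfl
            simp only [bind_val, bind_steps, op_val, op_steps, hc, decide_true, Bool.and_self,
              if_true, charge_val, charge_steps, ne_eq, not_false_eq_true]
            exact ⟨⟨a1, fun x y h => a2 x y (hFm x y h)⟩, fun _ => a3,
              fun y hy hne L hL => a2 _ _ (hy hne L hL), by omega⟩
          · have hno : i' ≠ i → ∀ L, P.Reaches J K (.job i') L → False :=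
              fun hne L hL => hc ⟨hne, hL.pos⟩
            rcases not_and_or.1 hc with hc' | hc'
            all_goals
              simp only [bind_val, bind_steps, op_val, op_steps, hc', decide_false,
                Bool.false_and, Bool.and_false, Bool.false_eq_true, if_false, pure_val, pure_steps]
            all_goals
              refine ⟨⟨hF, hFm⟩, fun hne L hL => ?_, fun y hy => hy, by omega⟩
            · exact hne.elim
            · exact (hno hne L hL).elim)
      refine ⟨h1.1, h1.2, fun i' hi' => h2 i' (List.mem_finRange i') hi', h4.trans ?_⟩
      simp only [List.map_const', List.length_finRange, List.sum_replicate, smul_eq_mul]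
      rw [mul_comm g]
    obtain ⟨k1, k2, k3, k4⟩ := ih (j :: b) js.length F₂.val hb' hP₂ rfl _ rfl
    rw [← hKdef] at k1 k2 k3 k4
    have hR : (loopD P T i (j :: js) (Function.update K₀ i k) (∑ v, Function.update K₀ i k v)
          b.length (P.block b) F).val =
          (loopD P T i js K (∑ v, K v) (j :: b).length (P.block (j :: b)) F₂.val).val ∧
        (loopD P T i (j :: js) (Function.update K₀ i k) (∑ v, Function.update K₀ i k v)
          b.length (P.block b) F).steps = 14 + F₁.steps + F₂.steps +
          (loopD P T i js K (∑ v, K v) (j :: b).length (P.block (j :: b)) F₂.val).steps := by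
      rw [hF₂, hF₁]
      by_cases h0 : (∑ v, K v) = 0
      · simp only [loopD, bind_val, bind_steps, op_val, op_steps, tick_steps, hpre,
          Function.update_self, hEq, hsum, List.length_cons, h0, decide_true, if_true]
        exact ⟨trivial, by ring⟩
      · simp only [loopD, bind_val, bind_steps, op_val, op_steps, tick_steps, hpre,
          Function.update_self, hEq, hsum, List.length_cons, h0, decide_false, Bool.false_eq_true,
          if_false, pure_val, pure_steps]
        exact ⟨trivial, by ring⟩
    rw [hR.1, hR.2]
    refine ⟨k1, fun x y h => k2 x y (hM₂ x y (hM₁ x y h)), fun L M hL hM hend hlt => ?_, ?_⟩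
    -- A block of length `b.length + 1` must be `j :: b` and is handled in this iteration, by either
    -- part according to the previous node; longer blocks are left to the induction hypothesis.
    · rcases Nat.lt_or_ge (b.length + 1) M.length with hlt' | hge
      · exact k3 L M hL hM hend hlt'
      · have hMl : M.length = b.length + 1 := by omega
        have h1 := hL.filter_eq i
        rw [List.filter_append, Problem.filter_block_self hM, ← hb'] at h1
        have hMe : M = j :: b := (List.append_inj' h1 (by simpa using hMl)).2
        have hLr := hL.of_append hM (k := js.length) (by omega)
        refine k2 _ _ ?_
        subst hMe
        match hu : P.endNode .start L with
        | .start => rw [hu] at hLr; exact hM₂ _ _ (hC₁ L hLr)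
        | .job i' =>
          rw [hu] at hLr
          exact hC₂ i' (by rintro rfl; exact hend hu) L hLr
        | .finish => exact absurd hu (Problem.endNode_ne_finish (by simp))
    · have : 14 + (22 * m₀ + 6) + ((22 * m₀ + g + 10) * g + 1) ≤ (g + 1) * (g + 26 * m₀ + 17) := by
        nlinarith
      rw [show (j :: js).length = js.length + 1 from rfl, Nat.mul_succ]
      omega

theorem solveConfig_spec {T : Table g} {i : Fin g} {K : Fin g → ℕ} {m m₀ : ℕ}
    (hJ : P.IsNumbering J) (hK : K i ≤ (J i).length) (hmK : m = ∑ v, K v)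
    (hT : ∀ K' i', (∀ v, K' v ≤ K v) → K' i < K i → 0 < K' i' →
      P.Correct J K' (.job i') (T K' i'))
    (hm : ∀ K u F, Pareto F → (∀ s ∈ F, P.Sound J K u s) → F.length ≤ m₀) (hm1 : 1 ≤ m₀) :
    P.Correct J K (.job i) (solveConfig P J T K m i).val ∧
      (solveConfig P J T K m i).steps ≤ (g + 1) * (g + 26 * m₀ + 17) * P.n + 2 * P.n + g + 5 := by
  have hJn := P.length_le_of_nodup (P.nodup_of_pairwise_prec (hJ i).1)
  have ht := takeRev_spec (K i) (J i) []
  rw [List.append_nil] at ht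
  have hb : P.block ([] : List (Fin P.n)) = ⟨0, 0, 0⟩ := by simp [Problem.block]
  have hF : Partial P J K (.job i) [dummySol] :=
    ⟨by simp [Pareto], ⟨dummySol, by simp, le_rfl, le_rfl⟩, fun s hs => by
      rw [List.mem_singleton.1 hs]; exact .inl ⟨rfl, rfl⟩⟩
  obtain ⟨h1, -, h3, h4⟩ := loopD_spec hJ hK hT hm hm1 ((J i).take (K i)).reverse [] (K i)
    [dummySol] (by simp) hF (by simp [hK]) _ rfl
  rw [Function.update_eq_self, ← hmK, hb, List.length_nil, ← ht.1] at h1 h3 h4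
  simp only [solveConfig, bind_val, bind_steps, op_val, op_steps, charge_val, charge_steps]
  refine ⟨⟨h1.pareto, h1.sound, fun L hL => ?_⟩, ?_⟩
  · obtain ⟨M, B, rfl, h0, hB, hM⟩ := Problem.exists_last_block L hL.endNode_eq
    exact h3 M B hL hB hM (List.length_pos_iff.2 h0)
  · have h5 : (takeRev (K i) (J i) []).val.length ≤ P.n := by
      rw [ht.1]; simp; omega
    have := Nat.mul_le_mul_left ((g + 1) * (g + 26 * m₀ + 17)) h5
    omega

end RoutingFlowShop

namespace RoutingFlowShop

variable {g : ℕ} {P : Problem g} {J : Fin g → List (Fin P.n)}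

/-! ### The lengths of the lists of solutions -/

namespace Problem

/-- The pairs of different job nodes. -/
abbrev arcs (g : ℕ) : Finset (Fin g × Fin g) := Finset.univ.offDiag

/-- Moves within a node cost nothing, so only the number of uses of each arc between different nodes
matters. -/
theorem exists_arc_counts (L : List (Fin P.n)) (u : Fin g) :
    ∃ m : arcs g → ℕ, (∀ p, m p ≤ L.length) ∧
      P.trav (.job u) L = ∑ p : arcs g, m p * P.dist (.job p.1.1) (.job p.1.2) := by
  induction L generalizing u with
  | nil => exact ⟨fun _ => 0, by simp, by simp⟩
  | cons x L ih =>
    obtain ⟨m, h1, h2⟩ := ih (P.loc x)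
    rw [List.length_cons, trav_cons, node, h2]
    by_cases hu : u = P.loc x
    · refine ⟨m, fun p => (h1 p).trans (Nat.le_succ _), ?_⟩
      rw [hu, P.dist_self, zero_add]
    · let q : arcs g := ⟨(u, P.loc x), by simpa using hu⟩
      refine ⟨fun p => m p + if p = q then 1 else 0, fun p => ?_, ?_⟩
      · have := h1 p
        dsimp only
        split_ifs <;> omega
      · simp only [Nat.cast_add, add_mul, Finset.sum_add_distrib]
        rw [add_comm]
        simp [q]

theorem asum_eq_sum_filter (L : List (Fin P.n)) :
    P.asum L = ∑ v, P.asum (L.filter (P.loc · = v)) := by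
  induction L with
  | nil => simp
  | cons x L ih =>
    have h : ∀ v, P.asum ((x :: L).filter (P.loc · = v)) =
        (if P.loc x = v then P.a x else 0) + P.asum (L.filter (P.loc · = v)) := fun v => by
      by_cases hv : P.loc x = v <;> simp [hv]
    simp only [h, Finset.sum_add_distrib, ← ih]
    simp

theorem Reaches.nodup (hJ : P.IsNumbering J) {K : Fin g → ℕ} {u : Node g} {L : List (Fin P.n)}
    (h : P.Reaches J K u L) : L.Nodup := by
  rw [List.nodup_iff_count_le_one]
  intro j
  have h1 : (L.filter (P.loc · = P.loc j)).Nodup :=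
    (P.nodup_of_pairwise_prec (hJ (P.loc j)).1).sublist (h.isPrefix _).sublist
  rw [← List.count_filter (p := (P.loc · = P.loc j)) (by simp)]
  exact List.nodup_iff_count_le_one.1 h1 j

end Problem

theorem Pareto.length_le_card {F : List (Sol g)} (h : Pareto F) {S : Finset ℝ}
    (hS : ∀ s ∈ F, s.f1 ∈ S) : F.length ≤ S.card := by
  have hn : (F.map Sol.f1).Nodup := by
    rw [List.Nodup, List.pairwise_map]
    exact h.imp fun h => h.1.ne
  rw [← List.length_map Sol.f1, ← List.toFinset_card_of_nodup hn]
  refine Finset.card_le_card fun x hx => ?_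
  simp only [List.mem_toFinset, List.mem_map] at hx
  obtain ⟨s, hs, rfl⟩ := hx
  exact hS s hs

/-- In a Pareto list the values `f1` are distinct. For fixed `K` the A-workload is fixed, so `f1` is
determined by the first node (g choices) and an arc count between 0 and n for each of the g² - g
arcs. The extra value 0 accounts for the dummy pair and the empty sequence. -/
theorem Pareto.length_le (hJ : P.IsNumbering J) {K : Fin g → ℕ} {u : Node g} {F : List (Sol g)}
    (h : Pareto F) (hs : ∀ s ∈ F, P.Sound J K u s) :
    F.length ≤ g * (P.n + 1) ^ (g * g - g) + 1 := by
  let φ : Fin g × (Problem.arcs g → Fin (P.n + 1)) → ℝ := fun q =>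
    (∑ v, P.asum ((J v).take (K v))) + (P.dist .start (.job q.1) +
      ∑ p : Problem.arcs g, ((q.2 p : ℕ) : ℝ) * P.dist (.job p.1.1) (.job p.1.2))
  refine (h.length_le_card (S := insert 0 (Finset.univ.image φ)) fun s hsF => ?_).trans ?_
  · rcases hs s hsF with ⟨h0, -⟩ | ⟨L, hL, h1, -⟩
    · simp [h0]
    · have hlen := P.length_le_of_nodup (hL.nodup hJ)
      rw [h1]
      cases L with
      | nil => simp [Problem.endA]
      | cons x L =>
        obtain ⟨m, hm1, hm2⟩ := Problem.exists_arc_counts L (P.loc x)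
        refine Finset.mem_insert_of_mem (Finset.mem_image.2 ⟨(P.loc x, fun p =>
          ⟨m p, by have := hm1 p; simp at hlen; omega⟩), Finset.mem_univ _, ?_⟩)
        simp only [φ, Problem.endA, Problem.trav_cons, Problem.node]
        rw [← hm2, Problem.asum_eq_sum_filter]
        simp only [hL.filter_eq]
  · refine (Finset.card_insert_le _ _).trans (Nat.add_le_add_right ?_ 1)
    refine Finset.card_image_le.trans (le_of_eq ?_)
    rw [Finset.card_univ, Fintype.card_prod, Fintype.card_fun, Fintype.card_coe,
      Finset.offDiag_card, Finset.card_univ, Fintype.card_fin, Fintype.card_fin]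

/-! ### Nested loops -/

/-- The arguments of the body of the nested loops, in the order of the enumeration. -/
def boxList (N : Fin g → ℕ) : List (Fin g) → (Fin g → ℕ) → ℕ → List ((Fin g → ℕ) × ℕ)
  | [], K, m => [(K, m)]
  | i :: is, K, m =>
    (List.range (N i + 1)).flatMap fun c => boxList N is (Function.update K i c) (m + c)

theorem mem_boxList {N : Fin g → ℕ} {is : List (Fin g)} (his : is.Nodup) {K K' : Fin g → ℕ}
    {m m' : ℕ} : (K', m') ∈ boxList N is K m ↔
      (∀ v, v ∉ is → K' v = K v) ∧ (∀ v ∈ is, K' v ≤ N v) ∧ m' = m + (is.map K').sum := by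
  induction is generalizing K m with
  | nil => simp [boxList, funext_iff]
  | cons i is ih =>
    rw [List.nodup_cons] at his
    simp only [boxList, List.mem_flatMap, List.mem_range, ih his.2, List.mem_cons, List.map_cons,
      List.sum_cons, not_or, forall_eq_or_imp]
    constructor
    · rintro ⟨c, hc, h1, h2, h3⟩
      have := h1 i his.1
      rw [Function.update_self] at this
      refine ⟨fun v hv => ?_, ⟨by omega, h2⟩, by omega⟩
      rw [h1 v hv.2, Function.update_of_ne hv.1]
    · rintro ⟨h1, ⟨h2, h3⟩, h4⟩
      refine ⟨K' i, by omega, fun v hv => ?_, h3, by omega⟩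
      by_cases hvi : v = i
      · rw [hvi, Function.update_self]
      · rw [Function.update_of_ne hvi, h1 v ⟨hvi, hv⟩]

theorem length_boxList_le {N : Fin g → ℕ} {n : ℕ} (hN : ∀ i, N i ≤ n) (is : List (Fin g))
    (K : Fin g → ℕ) (m : ℕ) : (boxList N is K m).length ≤ (n + 1) ^ is.length := by
  induction is generalizing K m with
  | nil => simp [boxList]
  | cons i is ih =>
    rw [boxList, List.length_flatMap, List.length_cons, pow_succ']
    refine (List.sum_le_card_nsmul _ ((n + 1) ^ is.length) ?_).trans ?_
    · simp only [List.mem_map]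
      rintro _ ⟨c, -, rfl⟩
      exact ih _ _
    · simp only [List.length_map, List.length_range, smul_eq_mul]
      exact Nat.mul_le_mul_right _ (by have := hN i; omega)

theorem boxList_ne_nil (N : Fin g → ℕ) (is : List (Fin g)) (K : Fin g → ℕ) (m : ℕ) :
    0 < (boxList N is K m).length := by
  induction is generalizing K m with
  | nil => simp [boxList]
  | cons i is ih =>
    have := ih (Function.update K i 0) (m + 0)
    rw [List.length_pos_iff_exists_mem] at this ⊢
    obtain ⟨p, hp⟩ := this
    exact ⟨p, List.mem_flatMap.2 ⟨0, by simp, hp⟩⟩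

theorem sum_map_add_const {α : Type*} (l : List α) (f : α → ℕ) (c : ℕ) :
    (l.map fun x => f x + c).sum = (l.map f).sum + c * l.length := by
  induction l with
  | nil => simp
  | cons x l ih => simp [ih, mul_add]; ring

/-- The loop overhead is charged to the innermost bodies, 7 steps per nesting level. -/
theorem forBox_spec {σ : Type} {N : Fin g → ℕ} {body : (Fin g → ℕ) → ℕ → σ → Timed σ}
    (I : σ → Prop) (Φ : (Fin g → ℕ) × ℕ → σ → Prop) (c : (Fin g → ℕ) × ℕ → ℕ) (is : List (Fin g))
    (K : Fin g → ℕ) (m : ℕ) (s : σ) (hI : I s)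
    (h : ∀ p ∈ boxList N is K m, ∀ s, I s → I (body p.1 p.2 s).val ∧ Φ p (body p.1 p.2 s).val ∧
      (∀ y, Φ y s → Φ y (body p.1 p.2 s).val) ∧ (body p.1 p.2 s).steps ≤ c p) :
    I (forBox N body is K m s).val ∧
      (∀ p ∈ boxList N is K m, Φ p (forBox N body is K m s).val) ∧
      (∀ y, Φ y s → Φ y (forBox N body is K m s).val) ∧
      (forBox N body is K m s).steps ≤
        ((boxList N is K m).map fun p => c p + (7 * is.length + 1)).sum := by
  induction is generalizing K m s with
  | nil =>
    obtain ⟨h1, h2, h3, h4⟩ := h (K, m) (by simp [boxList]) s hI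
    simp only [forBox, bind_val, bind_steps, tick_steps, boxList]
    refine ⟨h1, by simpa using h2, h3, ?_⟩
    simp only [List.map_cons, List.map_nil, List.sum_cons, List.sum_nil, List.length_nil]
    dsimp only at h4
    omega
  | cons i is ih =>
    obtain ⟨h1, h2, -, h4⟩ := forEach_spec (α := ℕ) (σ := σ) (l := List.range (N i + 1)) (s := s)
      (fun t => I t ∧ ∀ y, Φ y s → Φ y t)
      (fun x t => ∀ p ∈ boxList N is (Function.update K i x) (m + x), Φ p t)
      (fun x => 2 + ((boxList N is (Function.update K i x) (m + x)).map
        fun p => c p + (7 * is.length + 1)).sum)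
      (body := fun c s => do
        let K ← op (Function.update K i c)
        let m ← op (m + c)
        forBox N body is K m s) ⟨hI, fun _ h => h⟩ (fun x hx t ⟨ht, hst⟩ => by
          obtain ⟨k1, k2, k3, k4⟩ := ih (Function.update K i x) (m + x) t ht
            fun p hp => h p (List.mem_flatMap.2 ⟨x, hx, hp⟩)
          simp only [bind_val, bind_steps, op_val, op_steps]
          exact ⟨⟨k1, fun y hy => k3 y (hst y hy)⟩, k2, fun y hy p hp => k3 p (hy p hp),
            by omega⟩)
    simp only [forBox, bind_val, bind_steps, op_val, op_steps, tick_steps, forUp]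
    refine ⟨h1.1, fun p hp => ?_, h1.2, ?_⟩
    · obtain ⟨x, hx, hp⟩ := List.mem_flatMap.1 hp
      exact h2 x hx p hp
    · refine (show _ ≤ _ from Nat.add_le_add_left (Nat.add_le_add_left
        (Nat.add_le_add_left h4 _) _) _).trans ?_
      rw [boxList, List.map_flatMap, List.flatMap_def, List.sum_flatten, List.map_map,
        Function.comp_def]
      -- Each value of the coordinate costs 3 steps and the loop as a whole 4. The range of values
      -- is nonempty and each value contains at least one innermost body, so 7 per body is enough.
      have key : ∀ x, (2 + ((boxList N is (Function.update K i x) (m + x)).map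
          fun p => c p + (7 * is.length + 1)).sum + 1) + 4 ≤
          ((boxList N is (Function.update K i x) (m + x)).map
            fun p => c p + (7 * (i :: is).length + 1)).sum := fun x => by
        have hpos := boxList_ne_nil N is (Function.update K i x) (m + x)
        rw [sum_map_add_const, sum_map_add_const, List.length_cons]
        nlinarith
      have h5 := List.sum_le_sum (l := List.range (N i + 1)) fun x _ => key x
      rw [sum_map_add_const, List.length_range] at h5
      omega

theorem forUp_spec {σ : Type} {n : ℕ} {body : ℕ → σ → Timed σ} (I : ℕ → σ → Prop) (c : ℕ → ℕ)
    (h : ∀ k s, I k s → I (k + 1) (body k s).val ∧ (body k s).steps ≤ c k)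
    {s : σ} (hI : I 0 s) : I n (forUp n body s).val ∧
      (forUp n body s).steps ≤ ((List.range n).map fun k => c k + 1).sum + 1 := by
  suffices H : ∀ m a s, I a s → I (a + m) (forEach body (List.range' a m) s).val ∧
      (forEach body (List.range' a m) s).steps ≤
        ((List.range' a m).map fun k => c k + 1).sum + 1 by
    rw [forUp, List.range_eq_range']
    simpa using H n 0 s hI
  intro m
  induction m with
  | zero => exact fun a s hs => ⟨hs, by simp [forEach_nil]⟩
  | succ m ih =>
    intro a s hs
    obtain ⟨h1, h2⟩ := h a s hs
    obtain ⟨k1, k2⟩ := ih (a + 1) _ h1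
    rw [List.range'_succ, forEach_cons_val, forEach_cons_steps]
    refine ⟨by rwa [add_assoc, add_comm 1] at k1, ?_⟩
    simp only [List.map_cons, List.sum_cons]
    omega

/-- Every vector is visited in all n rounds at the cheap price `A`, but the expensive price `X` is
paid in at most one round, the one matching its norm. -/
theorem sum_range_ite_le {α : Type*} (l : List (α × ℕ)) (n A X : ℕ) :
    ((List.range n).map fun k => (l.map fun p => A + if p.2 = k + 1 then X else 0).sum).sum ≤
      l.length * (n * A + X) := by
  induction l with
  | nil => simp
  | cons p l ih =>
    simp only [List.map_cons, List.sum_cons, List.length_cons]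
    rw [List.sum_map_add, List.sum_map_add]
    have h1 : ((List.range n).map fun k => if p.2 = k + 1 then X else 0).sum ≤ X := by
      change ∑ k ∈ Finset.range n, _ ≤ X
      calc ∑ k ∈ Finset.range n, (if p.2 = k + 1 then X else 0)
          ≤ ∑ k ∈ Finset.range n, if p.2 - 1 = k then X else 0 :=
            Finset.sum_le_sum fun k _ => by split_ifs <;> omega
        _ ≤ X := by rw [Finset.sum_ite_eq]; split_ifs <;> simp
    have h2 : ((List.range n).map fun _ => A).sum = n * A := by simp
    rw [add_mul]
    omega

/-- The table contains correct lists for all configurations of norm at most `k`. -/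
def TableCorrect (P : Problem g) (J : Fin g → List (Fin P.n)) (N : Fin g → ℕ) (k : ℕ)
    (T : Table g) : Prop :=
  ∀ K i, (∀ v, K v ≤ N v) → 0 < K i → ∑ v, K v ≤ k → P.Correct J K (.job i) (T K i)

/-- Induction on the norm: a pre-configuration has strictly smaller norm, so its list is already
correct when it is read. -/
theorem mainStage_spec {N : Fin g → ℕ} {m₀ : ℕ} (hJ : P.IsNumbering J)
    (hN : ∀ i, N i = (J i).length)
    (hm : ∀ K u F, Pareto F → (∀ s ∈ F, P.Sound J K u s) → F.length ≤ m₀) (hm1 : 1 ≤ m₀) :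
    TableCorrect P J N P.n (mainStage P J N).val ∧
      (mainStage P J N).steps ≤ P.n * (g + 2) + (P.n + 1) ^ g * (P.n * (7 * g + 3) +
        g * ((g + 1) * (g + 26 * m₀ + 17) * P.n + 2 * P.n + g + 5 + g + 4)) + 1 := by
  set S := (g + 1) * (g + 26 * m₀ + 17) * P.n + 2 * P.n + g + 5 with hS
  set box := boxList N (List.finRange g) (fun _ => 0) 0 with hbox
  have hmem : ∀ p ∈ box, (∀ v, p.1 v ≤ N v) ∧ p.2 = ∑ v, p.1 v := fun p hp => by
    obtain ⟨-, h2, h3⟩ := (mem_boxList (List.nodup_finRange g)).1 hp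
    refine ⟨fun v => h2 v (List.mem_finRange v), ?_⟩
    rw [h3, zero_add, Fin.sum_univ_def]
  have hmem' : ∀ K : Fin g → ℕ, (∀ v, K v ≤ N v) → (K, ∑ v, K v) ∈ box := fun K hK =>
    (mem_boxList (List.nodup_finRange g)).2 ⟨fun v hv => absurd (List.mem_finRange v) hv,
      fun v _ => hK v, by rw [zero_add, Fin.sum_univ_def]⟩
  have hbody : ∀ k : ℕ, ∀ p ∈ box, ∀ T : Table g, TableCorrect P J N k T →
      ∀ R : Timed (Table g), R = (do
        if (← op (decide (p.2 = k + 1))) then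
          forEach (fun i T => do
            let c ← op (p.1 i)
            if (← op (decide (0 < c))) then
              let F ← solveConfig P J T p.1 p.2 i
              charge (g + 1) (Function.update T p.1 (Function.update (T p.1) i F))
            else
              return T) (List.finRange g) T
        else
          return T) →
      (∀ K i, 0 < K i → P.Correct J K (.job i) (T K i) → P.Correct J K (.job i) (R.val K i)) ∧
      (p.2 = k + 1 → ∀ i, 0 < p.1 i → P.Correct J p.1 (.job i) (R.val p.1 i)) ∧
      R.steps ≤ 2 + if p.2 = k + 1 then g * (S + g + 4) else 0 := by
    rintro k p hp T hT R rfl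
    obtain ⟨hp1, hp2⟩ := hmem p hp
    by_cases hk : p.2 = k + 1
    swap
    · simp only [bind_val, bind_steps, op_val, op_steps, hk, decide_false, Bool.false_eq_true,
        if_false, pure_val, pure_steps]
      exact ⟨fun _ _ _ h => h, by simp, by omega⟩
    rw [if_pos hk]
    simp only [bind_val, bind_steps, op_val, op_steps, decide_eq_true hk, if_true]
    obtain ⟨h1, h2, -, h4⟩ := forEach_spec (α := Fin g) (σ := Table g) (l := List.finRange g)
      (s := T) (body := fun i T => do
        let c ← op (p.1 i)
        if (← op (decide (0 < c))) then
          let F ← solveConfig P J T p.1 p.2 i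
          charge (g + 1) (Function.update T p.1 (Function.update (T p.1) i F))
        else
          return T)
      (fun T' => ∀ K i, 0 < K i → P.Correct J K (.job i) (T K i) →
        P.Correct J K (.job i) (T' K i))
      (fun i T' => 0 < p.1 i → P.Correct J p.1 (.job i) (T' p.1 i)) (fun _ => S + g + 3)
      (fun _ _ _ h => h) (fun i _ T' hT' => by
        by_cases hi : 0 < p.1 i
        · obtain ⟨c1, c2⟩ := solveConfig_spec (T := T') (i := i) (K := p.1) (m := p.2) hJ
            (by rw [← hN]; exact hp1 i) hp2 (fun K' i' h1 h2 h3 => by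
              refine hT' K' i' h3 (hT K' i' (fun v => (h1 v).trans (hp1 v)) h3 ?_)
              have := Finset.sum_lt_sum (s := Finset.univ) (fun v _ => h1 v)
                ⟨i, Finset.mem_univ i, h2⟩
              omega) hm hm1
          -- An assignment cannot spoil a correct entry: the only cell it touches receives a correct
          -- list.
          have hup : ∀ K' i', 0 < K' i' → P.Correct J K' (.job i') (T' K' i') →
              P.Correct J K' (.job i') (Function.update T' p.1 (Function.update (T' p.1) i
                (solveConfig P J T' p.1 p.2 i).val) K' i') := fun K' i' h h' => by
            by_cases hK : K' = p.1
            · subst hK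
              rw [Function.update_self]
              by_cases hi' : i' = i
              · subst hi'; rwa [Function.update_self]
              · rwa [Function.update_of_ne hi']
            · rwa [Function.update_of_ne hK]
          simp only [bind_val, bind_steps, op_val, op_steps, hi, decide_true, if_true, charge_val,
            charge_steps]
          exact ⟨fun K' i' h h' => hup K' i' h (hT' K' i' h h'),
            fun _ => by rwa [Function.update_self, Function.update_self],
            fun y hy hpos => hup _ _ hpos (hy hpos), by omega⟩
        · simp only [bind_val, bind_steps, op_val, op_steps, hi, decide_false, Bool.false_eq_true,
            if_false, pure_val, pure_steps]
          exact ⟨hT', fun h => h.elim, fun _ h => h, by omega⟩)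
    refine ⟨h1, fun _ i => h2 i (List.mem_finRange i), ?_⟩
    simp only [List.map_const', List.length_finRange, List.sum_replicate, smul_eq_mul] at h4
    have h5 : S + g + 3 + 1 = S + g + 4 := rfl
    rw [h5] at h4
    omega
  have hlen : box.length ≤ (P.n + 1) ^ g := by
    have := length_boxList_le (n := P.n) (fun i => (hN i).le.trans
      (P.length_le_of_nodup (P.nodup_of_pairwise_prec (hJ i).1))) (List.finRange g) (fun _ => 0) 0
    rwa [List.length_finRange] at this
  obtain ⟨h1, h2⟩ := forUp_spec (n := P.n) (σ := Table g) (s := fun _ _ => [])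
    (TableCorrect P J N) (fun k => 1 + g + (box.map fun p => (7 * g + 3) +
      if p.2 = k + 1 then g * (S + g + 4) else 0).sum) (body := fun k T => do
    let k ← op (k + 1)
    let K ← charge g (fun _ => 0)
    forBox N (fun K m T => do
      if (← op (decide (m = k))) then
        forEach (fun i T => do
          let c ← op (K i)
          if (← op (decide (0 < c))) then
            let F ← solveConfig P J T K m i
            charge (g + 1) (Function.update T K (Function.update (T K) i F))
          else
            return T) (List.finRange g) T
      else
        return T) (List.finRange g) K 0 T)
    (fun k T hT => by
      simp only [bind_val, bind_steps, op_val, op_steps, charge_val, charge_steps]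
      obtain ⟨f1, f2, -, f4⟩ := forBox_spec (N := N) (body := fun K m T => do
          if (← op (decide (m = k + 1))) then
            forEach (fun i T => do
              let c ← op (K i)
              if (← op (decide (0 < c))) then
                let F ← solveConfig P J T K m i
                charge (g + 1) (Function.update T K (Function.update (T K) i F))
              else
                return T) (List.finRange g) T
          else
            return T) (TableCorrect P J N k)
        (fun p T => p.2 = k + 1 → ∀ i, 0 < p.1 i → P.Correct J p.1 (.job i) (T p.1 i))
        (fun p => 2 + if p.2 = k + 1 then g * (S + g + 4) else 0)
        (List.finRange g) (fun _ => 0) 0 T hT (fun p hp T hT => by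
          obtain ⟨b1, b2, b3⟩ := hbody k p hp T hT _ rfl
          exact ⟨fun K i h1 h2 h3 => b1 K i h2 (hT K i h1 h2 h3), b2,
            fun y hy e i hi => b1 _ _ hi (hy e i hi), b3⟩)
      refine ⟨fun K i h1 h2 h3 => ?_, ?_⟩
      · rcases Nat.lt_or_ge k (∑ v, K v) with h | h
        · exact f2 _ (hmem' K h1) (by simp only; omega) i h2
        · exact f1 K i h1 h2 h
      · rw [List.length_finRange] at f4
        have e : (fun p : (Fin g → ℕ) × ℕ => (2 + if p.2 = k + 1 then g * (S + g + 4) else 0) +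
            (7 * g + 1)) = fun p => (7 * g + 3) + if p.2 = k + 1 then g * (S + g + 4) else 0 := by
          funext p; ring
        rw [e, ← hbox] at f4
        exact (Nat.add_le_add_left (Nat.add_le_add_left f4 _) _).trans (by omega))
    -- Norm at most 0 contradicts `0 < K i`, so the empty table is correct at the outset.
    (fun K i _ h h' => absurd (Finset.single_le_sum (fun v _ => Nat.zero_le (K v))
      (Finset.mem_univ i)) (by omega))
  refine ⟨h1, h2.trans (Nat.add_le_add_right ?_ 1)⟩
  have h3 := sum_range_ite_le box P.n (7 * g + 3) (g * (S + g + 4))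
  have h4 := Nat.mul_le_mul_right (P.n * (7 * g + 3) + g * (S + g + 4)) hlen
  have h5 := sum_map_add_const (List.range P.n) (fun k => (box.map fun p => (7 * g + 3) +
      if p.2 = k + 1 then g * (S + g + 4) else 0).sum) (g + 2)
  rw [List.length_range] at h5
  calc _ = ((List.range P.n).map fun k => (box.map fun p => (7 * g + 3) +
      if p.2 = k + 1 then g * (S + g + 4) else 0).sum + (g + 2)).sum := by
        congr 2; funext k; ring
    _ ≤ _ := by rw [h5]; linarith [mul_comm (g + 2) P.n]

end RoutingFlowShop

namespace RoutingFlowShop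

variable {g : ℕ} {P : Problem g} {J : Fin g → List (Fin P.n)}

/-! ### The final stage -/

theorem lastSol_spec (F : List (Sol g)) (hF : Pareto F) (s : Sol g) :
    ((F = [] ∧ (lastSol s F).val = s) ∨
      ((lastSol s F).val ∈ F ∧ ∀ t ∈ F, (lastSol s F).val.f2 ≤ t.f2)) ∧
      (lastSol s F).steps = F.length + 1 := by
  induction F generalizing s with
  | nil => simp [lastSol]
  | cons t F ih =>
    obtain ⟨h1, h2⟩ := ih (List.pairwise_cons.1 hF).2 t
    simp only [lastSol, bind_val, bind_steps, tick_steps, List.length_cons]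
    refine ⟨.inr ?_, by omega⟩
    rcases h1 with ⟨rfl, h⟩ | ⟨h3, h4⟩
    · rw [h]; simp
    · refine ⟨List.mem_cons_of_mem _ h3, fun u hu => ?_⟩
      rcases List.mem_cons.1 hu with rfl | hu
      · exact ((List.pairwise_cons.1 hF).1 _ h3).2.le
      · exact h4 u hu

/-- In a Pareto list the last element has the least `f2`, so one candidate per final node suffices.
The dummy pair can never win, because its value is not below `⊤`. -/
theorem finalStage_spec {T : Table g} {N : Fin g → ℕ} {m₀ : ℕ}
    (hT : ∀ i, P.Correct J N (.job i) (T N i)) (hm : ∀ i, (T N i).length ≤ m₀) :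
    ((finalStage P T N).val.1 = ⊤ ∨ ∃ i L, P.Reaches J N (.job i) L ∧
      (finalStage P T N).val.1 = (P.cost L : ℝ) ∧ P.Expands (finalStage P T N).val.2 L) ∧
    (∀ i L, P.Reaches J N (.job i) L → (finalStage P T N).val.1 ≤ (P.cost L : ℝ)) ∧
    (finalStage P T N).steps ≤ g * (m₀ + g + 6) + 1 := by
  have hcost : ∀ {i L}, P.Reaches J N (.job i) L →
      P.cost L = P.endB L + P.dist (.job i) .finish := fun {i L} h => by
    rw [Problem.cost, Problem.tour, Problem.endB, h.endNode_eq]; ring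
  obtain ⟨h1, h2, -, h4⟩ := forEach_spec (l := List.finRange g) (σ := WithTop ℝ × List (Fin g × ℕ))
    (s := (⊤, []))
    (fun b => b.1 = ⊤ ∨ ∃ i L, P.Reaches J N (.job i) L ∧ b.1 = (P.cost L : ℝ) ∧ P.Expands b.2 L)
    (fun i b => ∀ L, P.Reaches J N (.job i) L → b.1 ≤ (P.cost L : ℝ)) (fun _ => m₀ + g + 5)
    (body := fun i best => do
      let F ← charge (g + 1) (T N i)
      let s ← lastSol dummySol F
      let r ← op (P.dist (.job i) .finish)
      let v ← op (s.f2 + (r : WithTop ℝ))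
      if (← op (decide (v < best.1))) then
        return (v, s.route)
      else
        return best) (.inl rfl) (fun i _ b hb => by
      obtain ⟨l1, l2⟩ := lastSol_spec (T N i) (hT i).pareto dummySol
      have hmi := hm i
      simp only [bind_val, bind_steps, op_val, op_steps, charge_val, charge_steps]
      set s := (lastSol dummySol (T N i)).val
      set v := s.f2 + ((P.dist (.job i) .finish : ℝ) : WithTop ℝ) with hv
      have hΦ : ∀ L, P.Reaches J N (.job i) L → v ≤ (P.cost L : ℝ) := fun L hL => by
        obtain ⟨t, ht, -, ht2⟩ := (hT i).complete L hL
        rcases l1 with ⟨he, -⟩ | ⟨-, l4⟩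
        · rw [he] at ht; simp at ht
        · rw [hcost hL, hv, WithTop.coe_add]
          gcongr
          exact (l4 t ht).trans ht2
      by_cases hlt : v < b.1
      · simp only [hlt, decide_true, if_true, pure_val, pure_steps]
        refine ⟨?_, hΦ, fun y hy L hL => hlt.le.trans (hy L hL), by omega⟩
        rcases l1 with ⟨-, he⟩ | ⟨l3, -⟩
        · exfalso
          rw [hv, he] at hlt
          simp [dummySol] at hlt
        · rcases (hT i).sound s l3 with ⟨-, ht⟩ | ⟨L, hL, -, e, hx⟩
          · exfalso
            rw [hv, ht] at hlt
            simp at hlt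
          · exact .inr ⟨i, L, hL, by rw [hv, e, hcost hL, WithTop.coe_add], hx⟩
      · simp only [hlt, decide_false, Bool.false_eq_true, if_false, pure_val, pure_steps]
        exact ⟨hb, fun L hL => (not_lt.1 hlt).trans (hΦ L hL), fun y hy => hy, by omega⟩)
  refine ⟨h1, fun i => h2 i (List.mem_finRange i), h4.trans ?_⟩
  simp

/-! ### Restoring the schedule -/

/-- The job sequence `L` has been performed, and the machines have moved to `R.pos`. -/
structure Replay.Performed (R : Replay P) (J : Fin g → List (Fin P.n)) (L : List (Fin P.n)) :
    Prop where
  tA_eq : R.tA = P.endA L + P.dist (P.endNode .start L) R.pos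
  tB_eq : R.tB = P.endB L + P.dist (P.endNode .start L) R.pos
  rest_eq : ∀ v, L.filter (P.loc · = v) ++ R.rest v = J v
  start_le : ∀ j ∈ L, P.dist .start (P.node j) ≤ R.sched.startA j
  startB_ge : ∀ j ∈ L, R.sched.startA j + P.a j ≤ R.sched.startB j
  startA_le : ∀ j ∈ L, R.sched.startA j + P.a j + P.dist (P.node j) R.pos ≤ R.tA
  startB_le : ∀ j ∈ L, R.sched.startB j + P.b j + P.dist (P.node j) R.pos ≤ R.tB
  orderA : ∀ j ∈ L, ∀ k ∈ L, j ≠ k → P.Before P.a R.sched.startA j k ∨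
    P.Before P.a R.sched.startA k j
  orderB : ∀ j ∈ L, ∀ k ∈ L, j ≠ k → P.Before P.b R.sched.startB j k ∨
    P.Before P.b R.sched.startB k j
  last : L ≠ [] → ∃ j ∈ L, P.node j = P.endNode .start L ∧ R.sched.startB j + P.b j = P.endB L

theorem dist_start_le (L : List (Fin P.n)) : P.dist .start (P.endNode .start L) ≤ P.endA L := by
  have := P.tour_le_of_sublist (List.nil_sublist L) .start (P.endNode .start L)
  rw [Problem.tour_nil, Problem.tour, P.dist_self] at this
  have := P.asum_nonneg L
  unfold Problem.endA
  linarith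

theorem Replay.Performed.move {R : Replay P} {L : List (Fin P.n)} (h : R.Performed J L)
    (hpos : R.pos = P.endNode .start L) (w : Node g) :
    (⟨w, R.tA + P.dist R.pos w, R.tB + P.dist R.pos w, R.rest, R.sched⟩ : Replay P).Performed
      J L where
  tA_eq := by simp only; rw [h.tA_eq, hpos, P.dist_self, add_zero]
  tB_eq := by simp only; rw [h.tB_eq, hpos, P.dist_self, add_zero]
  rest_eq := h.rest_eq
  start_le := h.start_le
  startB_ge := h.startB_ge
  startA_le j hj := by
    have := h.startA_le j hj
    have := P.dist_triangle (P.node j) R.pos w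
    simp only; linarith
  startB_le j hj := by
    have := h.startB_le j hj
    have := P.dist_triangle (P.node j) R.pos w
    simp only; linarith
  orderA := h.orderA
  orderB := h.orderB
  last := h.last

/-- Starting each operation as early as possible reproduces the recurrences of `endA` and `endB` for
a one-job block. The old jobs precede `x` on both machines because their completion and travel times
are already bounded by the current clocks. -/
theorem Replay.Performed.step (hJ : P.IsNumbering J) {R : Replay P} {L : List (Fin P.n)}
    (h : R.Performed J L) {x : Fin P.n} {js : List (Fin P.n)} (hpos : R.pos = P.node x)
    (hx : R.rest (P.loc x) = x :: js) :
    (⟨R.pos, R.tA + P.a x, max R.tB (R.tA + P.a x) + P.b x, Function.update R.rest (P.loc x) js,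
      ⟨Function.update R.sched.startA x R.tA,
        Function.update R.sched.startB x (max R.tB (R.tA + P.a x))⟩⟩ : Replay P).Performed
      J (L ++ [x]) := by
  have hend : P.endNode .start (L ++ [x]) = P.node x := by simp [Problem.endNode_append]
  have hxi : ∀ j ∈ [x], P.loc j = P.loc x := by simp
  have hA : R.tA + P.a x = P.endA (L ++ [x]) := by
    rw [Problem.endA_append_block (List.cons_ne_nil _ _) hxi, h.tA_eq, hpos]
    simp [Problem.node]
  have hB : max R.tB (R.tA + P.a x) + P.b x = P.endB (L ++ [x]) := by
    rw [Problem.endB_append_block (List.cons_ne_nil _ _) hxi, h.tA_eq, h.tB_eq, hpos,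
      ← max_add_add_right]
    simp [Problem.node, P.b_nonneg, add_assoc]
  have hxL : x ∉ L := fun hmem => by
    have h1 := P.nodup_of_pairwise_prec (hJ (P.loc x)).1
    rw [← h.rest_eq, hx, List.nodup_append] at h1
    exact h1.2.2 x (by simp [hmem]) x (by simp) rfl
  have hne : ∀ j ∈ L, j ≠ x := fun j hj e => hxL (e ▸ hj)
  have hmem : ∀ {j}, j ∈ L ++ [x] → j ∈ L ∨ j = x := fun {j} hj => by simpa using hj
  have hd := P.dist_self (P.node x)
  have hax := P.a_nonneg x
  have hbx := P.b_nonneg x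
  have hmax := le_max_left R.tB (R.tA + P.a x)
  have hmax' := le_max_right R.tB (R.tA + P.a x)
  refine ⟨?_, ?_, ?_, ?_, ?_, ?_, ?_, ?_, ?_, ?_⟩
  · simp only; rw [hA, hend, hpos, hd, add_zero]
  · simp only; rw [hB, hend, hpos, hd, add_zero]
  · intro v
    simp only
    rw [List.filter_append]
    by_cases hv : v = P.loc x
    · subst hv
      rw [Function.update_self, Problem.filter_block_self hxi, List.append_assoc,
        List.singleton_append, ← hx, h.rest_eq]
    · rw [Function.update_of_ne hv, Problem.filter_block_ne hxi hv, List.append_nil, h.rest_eq]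
  · intro j hj
    rcases hmem hj with hj | rfl
    · simpa only [Function.update_of_ne (hne j hj)] using h.start_le j hj
    · simp only [Function.update_self]
      rw [h.tA_eq, ← hpos]
      have := P.dist_triangle .start (P.endNode .start L) R.pos
      have := dist_start_le L
      linarith
  · intro j hj
    rcases hmem hj with hj | rfl
    · simpa only [Function.update_of_ne (hne j hj)] using h.startB_ge j hj
    · simp only [Function.update_self]; exact hmax'
  · intro j hj
    rcases hmem hj with hj | rfl
    · simp only [Function.update_of_ne (hne j hj)]
      have := h.startA_le j hj
      linarith
    · simp only [Function.update_self, hpos, hd]; linarith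
  · intro j hj
    rcases hmem hj with hj | rfl
    · simp only [Function.update_of_ne (hne j hj)]
      have := h.startB_le j hj
      linarith
    · simp only [Function.update_self, hpos, hd]; linarith
  · have key : ∀ j ∈ L, P.Before P.a (Function.update R.sched.startA x R.tA) j x := fun j hj => by
      have := h.startA_le j hj
      simp only [Problem.Before, Function.update_of_ne (hne j hj), Function.update_self]
      rw [hpos] at this
      exact this
    intro j hj' k hk' hjk
    rcases hmem hj' with hj | rfl <;> rcases hmem hk' with hk | rfl
    · simpa only [Problem.Before, Function.update_of_ne (hne j hj),
        Function.update_of_ne (hne k hk)] using h.orderA j hj k hk hjk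
    · exact .inl (key j hj)
    · exact .inr (key k hk)
    · exact absurd rfl hjk
  · have key : ∀ j ∈ L, P.Before P.b
        (Function.update R.sched.startB x (max R.tB (R.tA + P.a x))) j x := fun j hj => by
      have := h.startB_le j hj
      simp only [Problem.Before, Function.update_of_ne (hne j hj), Function.update_self]
      rw [hpos] at this
      exact this.trans hmax
    intro j hj' k hk' hjk
    rcases hmem hj' with hj | rfl <;> rcases hmem hk' with hk | rfl
    · simpa only [Problem.Before, Function.update_of_ne (hne j hj),
        Function.update_of_ne (hne k hk)] using h.orderB j hj k hk hjk
    · exact .inl (key j hj)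
    · exact .inr (key k hk)
    · exact absurd rfl hjk
  · exact fun _ => ⟨x, by simp, hend.symm, by simpa only [Function.update_self] using hB⟩

theorem replayJobs_spec (hJ : P.IsNumbering J) {i : Fin g} (M : List (Fin P.n)) :
    ∀ (R : Replay P) (L js : List (Fin P.n)), R.Performed J L → R.pos = .job i →
    R.rest i = M ++ js → (∀ j ∈ M, P.loc j = i) →
    (replayJobs P i M.length R).val.Performed J (L ++ M) ∧
      (replayJobs P i M.length R).val.pos = .job i ∧
      (replayJobs P i M.length R).steps = 10 * M.length + 1 := by
  induction M with
  | nil =>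
    intro R L js h hp _ _
    simp only [List.length_nil, replayJobs, bind_val, bind_steps, tick_steps, pure_val, pure_steps,
      List.append_nil]
    exact ⟨h, hp, by trivial⟩
  | cons x M ih =>
    intro R L js h hp hr hM
    obtain rfl : P.loc x = i := hM x (by simp)
    obtain ⟨k1, k2, k3⟩ := ih _ (L ++ [x]) js (h.step hJ (js := M ++ js) hp hr) hp
      (by simp only [Function.update_self]) (fun j hj => hM j (by simp [hj]))
    simp only [List.length_cons, replayJobs, bind_val, bind_steps, tick_steps, op_val, op_steps, hr,
      List.cons_append]
    exact ⟨by simpa using k1, k2, by rw [k3]; ring⟩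

theorem forEach_append_val {α σ : Type} (body : α → σ → Timed σ) (l : List α) (x : α) (s : σ) :
    (forEach body (l ++ [x]) s).val = (body x (forEach body l s).val).val ∧
      (forEach body (l ++ [x]) s).steps =
        (forEach body l s).steps + (body x (forEach body l s).val).steps + 1 := by
  induction l generalizing s with
  | nil => exact ⟨rfl, by rw [List.nil_append, forEach_cons_steps]; simp [forEach_nil]; omega⟩
  | cons y l ih =>
    obtain ⟨h1, h2⟩ := ih (body y s).val
    rw [List.cons_append, forEach_cons_val, forEach_cons_steps, h1, h2, forEach_cons_val,
      forEach_cons_steps]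
    exact ⟨rfl, by omega⟩

theorem replay_spec (hJ : P.IsNumbering J) {rt : List (Fin g × ℕ)} {L : List (Fin P.n)}
    (hx : P.Expands rt L) : (∀ v, L.filter (P.loc · = v) <+: J v) →
    ∀ F : Timed (Replay P), F = forEach (fun (p : Fin g × ℕ) (R : Replay P) => do
      let r ← op (P.dist R.pos (.job p.1))
      let tA ← op (R.tA + r)
      let tB ← op (R.tB + r)
      replayJobs P p.1 p.2 ⟨.job p.1, tA, tB, R.rest, R.sched⟩) rt.reverse
        ⟨.start, 0, 0, J, ⟨fun _ => 0, fun _ => 0⟩⟩ →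
    F.val.Performed J L ∧ F.val.pos = P.endNode .start L ∧ F.steps ≤ 15 * L.length + 1 := by
  induction hx with
  | nil =>
    rintro - F rfl
    rw [List.reverse_nil, (forEach_nil _ _).1, (forEach_nil _ _).2]
    refine ⟨⟨?_, ?_, ?_, ?_, ?_, ?_, ?_, ?_, ?_, ?_⟩, rfl, by simp⟩ <;>
      simp [Problem.endA, Problem.endB, P.dist_self]
  | @cons rt L M i hx hM hi ih =>
    rintro hpre F rfl
    obtain ⟨h1, h2, h3⟩ := ih (fun v => by
      have := hpre v
      rw [List.filter_append] at this
      exact (List.prefix_append _ _).trans this) _ rfl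
    rw [List.reverse_cons, (forEach_append_val _ _ _ _).1, (forEach_append_val _ _ _ _).2]
    simp only [bind_val, bind_steps, op_val, op_steps]
    have h4 := h1.move h2 (.job i)
    have h5 := hpre i
    rw [List.filter_append, Problem.filter_block_self hi, ← h1.rest_eq,
      List.prefix_append_right_inj] at h5
    obtain ⟨js, h5⟩ := h5
    obtain ⟨k1, k2, k3⟩ := replayJobs_spec hJ M _ L js h4 rfl h5.symm hi
    -- A route step has 5 steps of overhead besides 10 per job; the block being nonempty, 15 per job
    -- cover both.
    have hpos := List.length_pos_iff.2 hM
    refine ⟨k1, ?_, ?_⟩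
    · rw [k2, Problem.endNode_append, (P.trav_endNode_block hM hi).2]
    · rw [k3, List.length_append]
      omega

theorem Problem.Expands.length_le {rt : List (Fin g × ℕ)} {L : List (Fin P.n)}
    (h : P.Expands rt L) : rt.length ≤ L.length := by
  induction h with
  | nil => simp
  | cons h hM hi ih =>
    have := List.length_pos_iff.2 hM
    simp only [List.length_cons, List.length_append]
    omega

/-- The makespan is at most `cost` by the bound on the B-clock and the triangle inequality. It is at
least `cost` by the job recorded in the field `last`, completed on B at time `endB` at the final
node. -/
theorem restore_spec (hJ : P.IsNumbering J) {N : Fin g → ℕ} (hN : ∀ i, N i = (J i).length)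
    (hn : 0 < P.n) {i : Fin g} {L : List (Fin P.n)} (hL : P.Reaches J N (.job i) L)
    {rt : List (Fin g × ℕ)} (hx : P.Expands rt L) :
    (restore P J rt).val.Feasible ∧ (restore P J rt).val.makespan = P.cost L ∧
      (restore P J rt).steps ≤ 18 * P.n + 2 := by
  have hmem : ∀ j, j ∈ L := fun j => by
    have h := hL.filter_eq (P.loc j)
    rw [hN, List.take_length] at h
    have : j ∈ L.filter (P.loc · = P.loc j) := by rw [h]; exact ((hJ _).2 j).2 rfl
    exact (List.mem_filter.1 this).1
  have hlen := P.length_le_of_nodup (hL.nodup hJ)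
  have hlen' := hx.length_le
  obtain ⟨h1, h2, h3⟩ := replay_spec hJ hx hL.isPrefix _ rfl
  have hrw := rewind_spec rt []
  rw [List.append_nil] at hrw
  simp only [restore, bind_val, bind_steps, charge_val, charge_steps, pure_val, pure_steps, hrw]
  generalize (forEach _ rt.reverse (⟨.start, 0, 0, J, ⟨fun _ => 0, fun _ => 0⟩⟩ : Replay P)) = F
    at h1 h2 h3 ⊢
  refine ⟨⟨⟨fun j => h1.start_le j (hmem j), fun j k => h1.orderA j (hmem j) k (hmem k)⟩,
    ⟨fun j => ?_, fun j k => h1.orderB j (hmem j) k (hmem k)⟩,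
    fun j => h1.startB_ge j (hmem j)⟩, ?_, by omega⟩
  · have := h1.start_le j (hmem j)
    have := h1.startB_ge j (hmem j)
    have := P.a_nonneg j
    unfold Problem.node at *
    linarith
  · have hcost : P.cost L = P.endB L + P.dist (P.endNode .start L) .finish := by
      rw [Problem.cost, Problem.tour, Problem.endB]; ring
    have : Nonempty (Fin P.n) := ⟨⟨0, hn⟩⟩
    refine le_antisymm (ciSup_le fun j => ?_) ?_
    · have := h1.startB_le j (hmem j)
      rw [h1.tB_eq, h2, P.dist_self, add_zero] at this
      have := P.dist_triangle (P.node j) (P.endNode .start L) .finish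
      unfold Problem.node at *
      linarith
    · obtain ⟨j, -, e1, e2⟩ := h1.last (List.ne_nil_of_mem (hmem ⟨0, hn⟩))
      have := Problem.le_makespan F.val.sched j
      rw [hcost, ← e1, ← e2]
      exact this

/-! ### Correctness and running time -/

/-- After sorting, the jobs of each node form a list ordered by `Prec` with the same elements as `J
v`, hence equal to it. -/
theorem exists_reaches_cost_le (hJ : P.IsNumbering J) {N : Fin g → ℕ}
    (hN : ∀ i, N i = (J i).length) (hn : 0 < P.n) {τ : List (Fin P.n)}
    (hτ : τ.Nodup) (hτm : ∀ j, j ∈ τ) :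
    ∃ i L, P.Reaches J N (.job i) L ∧ P.cost L ≤ P.cost τ := by
  obtain ⟨L, hp, hs, hc'⟩ := P.exists_sorted_perm τ hτ
  have hLn : L.Nodup := hp.nodup_iff.2 hτ
  have hLm : ∀ j, j ∈ L := fun j => hp.mem_iff.2 (hτm j)
  have hf : ∀ v, L.filter (P.loc · = v) = J v := fun v => by
    refine List.Perm.eq_of_pairwise (le := P.Prec)
      (fun a b _ _ h h' => absurd (h.trans h') (P.not_prec_self a)) ?_ (hJ v).1 ?_
    · refine List.Pairwise.imp_of_mem (fun {x y} hx hy h => ?_) (hs.filter _)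
      simp only [List.mem_filter, decide_eq_true_eq] at hx hy
      exact h (hx.2.trans hy.2.symm)
    · refine (List.perm_ext_iff_of_nodup (hLn.filter _) (P.nodup_of_pairwise_prec (hJ v).1)).2 ?_
      intro j
      simp [(hJ v).2 j, hLm j]
  have hne : L ≠ [] := List.ne_nil_of_mem (hLm ⟨0, hn⟩)
  match hu : P.endNode .start L with
  | .start => exact absurd (Problem.endNode_eq_start hu) hne
  | .finish => exact absurd hu (Problem.endNode_ne_finish (by simp))
  | .job i =>
    refine ⟨i, L, ⟨fun v => by rw [hf v], ?_, hu⟩, hc'⟩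
    funext v
    rw [Problem.count, hf v, hN]

/-- The dynamic programming algorithm is correct; a bound on the number of its steps. -/
theorem algDP_spec (hg : 0 < g) (P : Problem g) :
    (algDP P).val.schedule.IsOptimal ∧
    (algDP P).val.value = (((algDP P).val.schedule.makespan : ℝ) : WithTop ℝ) ∧
    ∀ m₀, m₀ = g * (P.n + 1) ^ (g * g - g) + 1 → (algDP P).steps ≤
      (g + ((15 * (P.n + 1) + 4) * P.n + 1)) + (g + (5 * P.n + 1)) +
      (P.n * (g + 2) + (P.n + 1) ^ g * (P.n * (7 * g + 3) +
        g * ((g + 1) * (g + 26 * m₀ + 17) * P.n + 2 * P.n + g + 5 + g + 4)) + 1) +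
      (g * (m₀ + g + 6) + 1) + (18 * P.n + 2) := by
  obtain ⟨hJ, s1⟩ := sortJobs_spec P
  obtain ⟨hN, s2⟩ := countJobs_spec P hJ
  obtain ⟨hT, s3⟩ := mainStage_spec hJ hN (fun K u F h => h.length_le hJ) (Nat.le_add_left 1 _)
  obtain ⟨j₀, -⟩ := P.loc_surjective ⟨0, hg⟩
  have hn : 0 < P.n := j₀.pos
  simp only [algDP, bind_val, bind_steps, pure_val, pure_steps]
  set J := (sortJobs P).val
  set N := (countJobs P).val
  set T := (mainStage P J N).val
  have hpos : ∀ i, 0 < N i := fun i => by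
    obtain ⟨j, hj⟩ := P.loc_surjective i
    rw [hN]
    exact List.length_pos_of_mem (((hJ i).2 j).2 hj)
  have hsum : ∑ v, N v ≤ P.n := by
    have h : ∀ v, N v = (Finset.univ.filter fun j => P.loc j = v).card := fun v => by
      rw [hN, ← List.toFinset_card_of_nodup (P.nodup_of_pairwise_prec (hJ v).1)]
      congr 1
      ext j
      simp [(hJ v).2 j]
    simp only [h]
    rw [Finset.sum_card_fiberwise_eq_card_filter]
    simp
  have hTi : ∀ i, P.Correct J N (.job i) (T N i) := fun i => hT N i (fun _ => le_rfl) (hpos i) hsum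
  obtain ⟨f1, f2, s4⟩ := finalStage_spec hTi fun i => (hTi i).pareto.length_le hJ (hTi i).sound
  set best := (finalStage P T N).val
  have hle : ∀ S : Schedule P, S.Feasible → best.1 ≤ (S.makespan : ℝ) := fun S hS => by
    obtain ⟨τ, hτ, hτm, hc⟩ := Problem.exists_cost_le_makespan hn hS
    obtain ⟨i, L, hL, hc'⟩ := exists_reaches_cost_le hJ hN hn hτ hτm
    exact (f2 i L hL).trans (WithTop.coe_le_coe.2 (hc'.trans hc))
  -- The value is finite because at least one sequence reaches the full configuration, for instance
  -- a sorted rearrangement of all jobs.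
  obtain ⟨i, L, hL, hb, hx⟩ := f1.resolve_left fun htop => by
    obtain ⟨i, L, hL, -⟩ := exists_reaches_cost_le hJ hN hn (List.nodup_finRange P.n)
      List.mem_finRange
    have := f2 i L hL
    rw [htop] at this
    exact absurd this (by simp)
  obtain ⟨r1, r2, s5⟩ := restore_spec hJ hN hn hL hx
  refine ⟨⟨r1, fun S hS => ?_⟩, by rw [hb, r2], ?_⟩
  · rw [r2]
    have := hle S hS
    rwa [hb, WithTop.coe_le_coe] at this
  · rintro m₀ rfl
    omega

/-! ### Estimating the step count by a power of n -/

theorem steps_bound (g : ℕ) (hg : 0 < g) : ∃ c : ℕ, ∀ n m : ℕ, 0 < n →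
    m = g * (n + 1) ^ (g * g - g) + 1 →
    (g + ((15 * (n + 1) + 4) * n + 1)) + (g + (5 * n + 1)) +
      (n * (g + 2) + (n + 1) ^ g * (n * (7 * g + 3) +
        g * ((g + 1) * (g + 26 * m + 17) * n + 2 * n + g + 5 + g + 4)) + 1) +
      (g * (m + g + 6) + 1) + (18 * n + 2) ≤ c * n ^ (g ^ 2 + 1) := by
  set e := g * g - g with he
  set D := g * 2 ^ e + 1 with hD
  set A := (7 * g + 3) + g * ((g + 1) * (g + 17) + 2 * g + 11) with hA
  set C := A + g * ((g + 1) * 26) with hC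
  refine ⟨2 * g + 50 + 15 + 42 + (g + 2) + 2 ^ g * D * C + (g * D + g * (g + 6)), ?_⟩
  intro n m hn hm
  set X := n ^ (g ^ 2 + 1) with hX
  have hgg : g ≤ g * g := Nat.le_mul_self g
  have hX1 : 1 ≤ X := Nat.one_le_pow _ _ hn
  have hXn : n ≤ X := Nat.le_self_pow (by omega) n
  have hXn2 : n * n ≤ X := by
    rw [← pow_two]
    exact Nat.pow_le_pow_right hn (by nlinarith)
  have hmD : m ≤ D * n ^ e := by
    have h1 : (n + 1) ^ e ≤ 2 ^ e * n ^ e := by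
      rw [← mul_pow]; exact Nat.pow_le_pow_left (by omega) e
    have h2 : 1 ≤ n ^ e := Nat.one_le_pow _ _ hn
    calc m = g * (n + 1) ^ e + 1 := hm
      _ ≤ g * (2 ^ e * n ^ e) + n ^ e := Nat.add_le_add (Nat.mul_le_mul_left g h1) h2
      _ = D * n ^ e := by rw [hD]; ring
  have hm1 : 1 ≤ m := by omega
  have hmX : m ≤ D * X := hmD.trans (Nat.mul_le_mul_left D
    (Nat.pow_le_pow_right hn (by rw [pow_two]; omega)))
  have hQ : (n + 1) ^ g * n * m ≤ 2 ^ g * D * X := by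
    have h1 : (n + 1) ^ g ≤ 2 ^ g * n ^ g := by
      rw [← mul_pow]; exact Nat.pow_le_pow_left (by omega) g
    calc (n + 1) ^ g * n * m ≤ (2 ^ g * n ^ g) * n * (D * n ^ e) := by gcongr
      _ = 2 ^ g * D * n ^ (g + 1 + e) := by rw [pow_add, pow_succ]; ring
      _ = 2 ^ g * D * X := by
        -- Vectors `K` contribute g, block lengths 1, and list lengths `e = g² - g`; all other terms
        -- are of lower or equal order.
        have : g + 1 + e = g ^ 2 + 1 := by rw [pow_two]; omega
        rw [this]
  have hmain : (n + 1) ^ g * (n * (7 * g + 3) +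
      g * ((g + 1) * (g + 26 * m + 17) * n + 2 * n + g + 5 + g + 4)) ≤ 2 ^ g * D * C * X := by
    have h1 : n * (7 * g + 3) + g * ((g + 1) * (g + 26 * m + 17) * n + 2 * n + g + 5 + g + 4) ≤
        n * m * C := by
      have h2 : g * (2 * g + 9) ≤ g * (2 * g + 9) * n := Nat.le_mul_of_pos_right _ hn
      have h3 : n * A ≤ n * A * m := Nat.le_mul_of_pos_right _ hm1
      calc n * (7 * g + 3) + g * ((g + 1) * (g + 26 * m + 17) * n + 2 * n + g + 5 + g + 4)
          = n * (7 * g + 3) + g * ((g + 1) * (g + 26 * m + 17) + 2) * n + g * (2 * g + 9) := by ring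
        _ ≤ n * (7 * g + 3) + g * ((g + 1) * (g + 26 * m + 17) + 2) * n +
            g * (2 * g + 9) * n := Nat.add_le_add_left h2 _
        _ = n * A + n * m * (g * ((g + 1) * 26)) := by rw [hA]; ring
        _ ≤ n * A * m + n * m * (g * ((g + 1) * 26)) := Nat.add_le_add_right h3 _
        _ = n * m * C := by rw [hC]; ring
    calc _ ≤ (n + 1) ^ g * (n * m * C) := Nat.mul_le_mul_left _ h1
      _ = (n + 1) ^ g * n * m * C := by ring
      _ ≤ 2 ^ g * D * X * C := Nat.mul_le_mul_right C hQ
      _ = _ := by ring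
  have t1 : 2 * g + 50 ≤ (2 * g + 50) * X := Nat.le_mul_of_pos_right _ hX1
  have t2 : n * (g + 2) ≤ X * (g + 2) := Nat.mul_le_mul_right _ hXn
  have t3 : g * m ≤ g * (D * X) := Nat.mul_le_mul_left g hmX
  have t4 : g * (g + 6) ≤ g * (g + 6) * X := Nat.le_mul_of_pos_right _ hX1
  have t5 : (15 * (n + 1) + 4) * n = 15 * (n * n) + 19 * n := by ring
  have t6 : g * (m + g + 6) = g * m + g * (g + 6) := by ring
  rw [t5, t6]
  calc _ ≤ (2 * g + 50) * X + 15 * X + 42 * X + X * (g + 2) + 2 ^ g * D * C * X +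
        (g * (D * X) + g * (g + 6) * X) := by omega
    _ = _ := by ring

end RoutingFlowShop

theorem theorem3 (g : ℕ) (hg : 0 < g) :
    (∀ P : RoutingFlowShop.Problem g,
      (RoutingFlowShop.algDP P).val.schedule.IsOptimal ∧
      (RoutingFlowShop.algDP P).val.value =
        (((RoutingFlowShop.algDP P).val.schedule.makespan : ℝ) : WithTop ℝ)) ∧
    ∃ c : ℕ, ∀ P : RoutingFlowShop.Problem g,
      (RoutingFlowShop.algDP P).steps ≤ c * P.n ^ (g ^ 2 + 1) := by
  refine ⟨fun P => ⟨(RoutingFlowShop.algDP_spec hg P).1, (RoutingFlowShop.algDP_spec hg P).2.1⟩, ?_⟩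
  obtain ⟨c, hc⟩ := RoutingFlowShop.steps_bound g hg
  refine ⟨c, fun P => ?_⟩
  obtain ⟨j, -⟩ := P.loc_surjective ⟨0, hg⟩
  exact ((RoutingFlowShop.algDP_spec hg P).2.2 _ rfl).trans (hc P.n _ j.pos rfl)
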